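/- **Setting.** Let $\Lambda=(\Lambda_s,\Lambda_b)$ be a finite connected graph with graph distance $\mathrm{dist}$. It has dimension $D$ with constant $C_0$ if $|\{\ell:\mathrm{dist}(\ell,m)=r\}|\le C_0r^{D-1}$ for all $m\in\Lambda_s$ and all integers $r\ge 1$. On the fermion Fock space over the modes $(i,\mu)$, $i\in\Lambda_s$, $\mu\in\{\uparrow,\downarrow\}$, consider $$H_\Lambda=-\sum_{\{i,j\}\in\Lambda_b}\sum_{\mu=\uparrow,\downarrow}\left(t_{i,j}c_{i,\mu}^\dagger c_{j,\mu}+t_{i,j}^*c_{j,\mu}^\dagger c_{i,\mu}\right)+V(\{n_{i,\mu}\})+\sum_{i\in\Lambda_s}\mathbf B_i\cdot\mathbf S_i ,$$ where $t_{i,j}\in\mathbb C$ (with $t_{j,i}=t_{i,j}^*$), $n_{i,\mu}=c^\dagger_{i,\mu}c_{i,\mu}$, $\mathbf B_i\in\mathbb R^3$, $S_i^a=\sum_{\mu,\nu}c^\dagger_{i,\mu}\sigma^a_{\mu,\nu}c_{i,\nu}$ with the Pauli matrices $\sigma^a$, and $S_i^\pm=S_i^x\pm iS_i^y$. The couplings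 are uniformly bounded and the interaction has finite range: $|t_{i,j}|\le t_{\max}$ on bonds, $|B_i^a|\le B_{\max}$, and $V=\sum_{X\subset\Lambda_s}V_X$, where $V_X$ is a real function of the $n_{i,\mu}$ with $i\in X$, $|V_X|\le V_{\max}$, and $V_X=0$ if $X$ contains two sites at distance larger than $r_0$. For a subspace $\mathcal K$ invariant under $H_\Lambda$, a *ground-state sector with gap larger than $\Delta E$* is a nonempty set $\sigma_0$ of eigenvalues of $H_\Lambda|_{\mathcal K}$ such that $E'-E>\Delta E$ for every $E\in\sigma_0$ and every other eigenvalue $E'\notin\sigma_0$ of $H_\Lambda|_{\mathcal K}$. Let $P_0$ be the orthogonal projection onto the span of the eigenvectors of $H_\Lambda$ in $\mathcal K$ with eigenvalues in $\sigma_0$, let $q$ be its rank, and put $\langle A\rangle_0=q^{-1}\,\mathrm{Tr}(AP_0)$. Given a sequence of such lattices and Hamiltonians with $|\Lambda_s|\to\infty$, and for each of them a subspace $\mathcal K$ and a set $\sigma_0$, there is a *uniform gap* $\Delta E$ if every $\sigma_0$ is a ground-state sector with gap larger than $\Delta E$ and $\max_{E,E'\in\sigma_0}|E-E'|\to0$.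 The degeneracy $q$ may depend on $\Lambda$ and need not stay bounded. A bound holds *in the thermodynamic limit* if for every $R$ it holds, for all sites $m,n$ with $\mathrm{dist}(m,n)\le R$, in all sufficiently far members of the sequence (how far may depend on $R$). **Theorem.** Let $1\le D<2$, $C_0>0$, $\Delta E>0$, and let $t_{\max},V_{\max},B_{\max},r_0$ be given. There are constants $\gamma,\gamma',\mathrm{Const.}>0$, depending only on these data, such that the following holds for every sequence of lattices and Hamiltonians as above with $|\Lambda_s|\to\infty$ and with these $D,C_0,t_{\max},V_{\max},B_{\max},r_0$. 1. Let $\mathcal K$ be the subspace of particle number $N$ (where $N$ may depend on $\Lambda$), and suppose that there is a uniform gap $\Delta E$. Then, in the thermodynamic limit, for $\mu=\uparrow,\downarrow$, $$\left|\langle c^\dagger_{m,\mu}c_{n,\mu}\rangle_0\right|\le\mathrm{Const.}\,\exp\left[-\gamma\{\mathrm{dist}(m,n)\}^{1-D/2}\right],$$ $$\left|\langle c^\dagger_{m,\uparrow}c^\dagger_{m,\downarrow}c_{n,\uparrow}c_{n,\downarrow}\rangle_0\right|\le\mathrm{Const.}\,\exp\left[-2\gamma\{\mathrm{dist}(m,n)\}^{1-D/2}\right].$$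 If moreover all fields have the form $\mathbf B_i=(0,0,B_i)$, then also $$\left|\langle S_m^+S_n^-\rangle_0\right|\le\mathrm{Const.}\,\exp\left[-\gamma'\{\mathrm{dist}(m,n)\}^{1-D/2}\right].$$ 2. If all fields have the form $\mathbf B_i=(0,0,B_i)$, then the three bounds also hold, with the same constants, when $\mathcal K$ is instead the subspace of fixed particle number and fixed total magnetization $\sum_iS_i^z$ (both may depend on $\Lambda$) and a uniform gap $\Delta E$ is assumed there. -/

import Mathlib

open Filter Topology

noncomputable section

namespace LatticeElectron

/-! ### Fermion Fock space -/

/-- The `z` component of the electron spin: `0` is up, `1` is down. -/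
abbrev Spin : Type := Fin 2

abbrev up : Spin := 0

abbrev down : Spin := 1

/-- One-electron modes `(i, μ)`. They are ordered lexicographically; the order only serves to fix
the signs of the fermion operators in the occupation-number basis. -/
abbrev Mode (Λ : Type) : Type := Λ ×ₗ Spin

abbrev mode {Λ : Type} (i : Λ) (μ : Spin) : Mode Λ := toLex (i, μ)

/-- Operators on the Fock space, as matrices in the occupation-number basis. A basis vector is
labelled by the set `S` of occupied modes, so `n_{i,μ} = 1` on it iff `mode i μ ∈ S`. -/
abbrev Op (Λ : Type) : Type := Matrix (Finset (Mode Λ)) (Finset (Mode Λ)) ℂ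

/-- The fermion Fock space over the modes of `Λ`, the occupation-number basis being orthonormal. -/
abbrev Fock (Λ : Type) : Type := EuclideanSpace ℂ (Finset (Mode Λ))

variable {Λ : Type} [Fintype Λ] [LinearOrder Λ]

/-- The annihilation operator `c_{i,μ}`: it sends the basis vector `T` to `0` if the mode is empty
and otherwise to `(-1)^#{occupied modes before (i, μ)}` times the basis vector `T \ {(i, μ)}`. -/
def annihilate (i : Λ) (μ : Spin) : Op Λ :=
  Matrix.of fun S T =>
    if mode i μ ∈ T ∧ S = T.erase (mode i μ) then
      (-1 : ℂ) ^ (T.filter fun y => y < mode i μ).card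
    else 0

/-- The creation operator `c†_{i,μ}`. -/
def create (i : Λ) (μ : Spin) : Op Λ := (annihilate i μ).conjTranspose

/-- The number operator `n_{i,μ} = c†_{i,μ} c_{i,μ}`. -/
def number (i : Λ) (μ : Spin) : Op Λ := create i μ * annihilate i μ

variable (Λ) in
/-- The total number operator. -/
def totalNumber : Op Λ := ∑ i : Λ, ∑ μ : Spin, number i μ

/-- The Pauli matrices `σ^x, σ^y, σ^z` for `a = 0, 1, 2`. -/
def pauli : Fin 3 → Matrix Spin Spin ℂ :=
  ![!![0, 1; 1, 0], !![0, -Complex.I; Complex.I, 0], !![1, 0; 0, -1]]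

/-- The spin operator `S_i^a = ∑_{μ,ν} c†_{i,μ} σ^a_{μ,ν} c_{i,ν}`. -/
def spin (i : Λ) (a : Fin 3) : Op Λ :=
  ∑ μ : Spin, ∑ ν : Spin, pauli a μ ν • (create i μ * annihilate i ν)

/-- `S_i^+ = S_i^x + i S_i^y`. -/
def spinPlus (i : Λ) : Op Λ := spin i 0 + Complex.I • spin i 1

/-- `S_i^- = S_i^x - i S_i^y`. -/
def spinMinus (i : Λ) : Op Λ := spin i 0 - Complex.I • spin i 1

variable (Λ) in
/-- The `z` component of the total spin, `∑_i S_i^z`. -/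
def totalSpinZ : Op Λ := ∑ i : Λ, spin i 2

/-! ### The model -/

/-- The data of the electron model on a finite lattice with set of sites `Λ`: the bonds, the
hopping amplitudes, the interaction as a real function of the occupation numbers (that is, of the
set of occupied modes), and the local magnetic fields. -/
structure Model (Λ : Type) where
  graph : SimpleGraph Λ
  hop : Λ → Λ → ℂ
  hop_symm : ∀ i j, graph.Adj i j → hop j i = star (hop i j)
  interaction : Finset (Mode Λ) → ℝ
  field : Λ → Fin 3 → ℝ

open Classical in
/-- The hopping term `-∑_{{i,j}} ∑_μ (t_{i,j} c†_{i,μ} c_{j,μ} + t_{i,j}^* c†_{j,μ} c_{i,μ})`.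
As `t_{j,i} = t_{i,j}^*`, the two summands of a bond are the terms of its two orientations,
so this is a sum over ordered pairs of neighbours. -/
def Model.hopping (M : Model Λ) : Op Λ :=
  -∑ i : Λ, ∑ j : Λ, if M.graph.Adj i j then
    ∑ μ : Spin, M.hop i j • (create i μ * annihilate j μ) else 0

/-- The Hamiltonian: hopping, the interaction `V({n_{i,μ}})` (diagonal in the occupation-number
basis), and the Zeeman term `∑_i B_i · S_i`. -/
def Model.hamiltonian (M : Model Λ) : Op Λ :=
  M.hopping + Matrix.diagonal (fun S => (M.interaction S : ℂ))
    + ∑ i : Λ, ∑ a : Fin 3, (M.field i a : ℂ) • spin i a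

/-- `V` is a sum of terms `φ X`, each depending only on the occupation numbers at the sites in `X`,
vanishing if `X` has two sites at distance larger than `r₀`, and bounded by `Vmax`. -/
def IsFiniteRange (G : SimpleGraph Λ) (V : Finset (Mode Λ) → ℝ) (r₀ : ℕ) (Vmax : ℝ) : Prop :=
  ∃ φ : Finset Λ → Finset (Mode Λ) → ℝ,
    (∀ X S T, (∀ i ∈ X, ∀ μ : Spin, mode i μ ∈ S ↔ mode i μ ∈ T) → φ X S = φ X T) ∧
    (∀ X, (∃ i ∈ X, ∃ j ∈ X, r₀ < G.dist i j) → ∀ S, φ X S = 0) ∧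
    (∀ X S, |φ X S| ≤ Vmax) ∧
    ∀ S, V S = ∑ X : Finset Λ, φ X S

/-- `G` has (fractal) dimension `D` with constant `C₀`: spheres of radius `r ≥ 1` have at most
`C₀ r^(D-1)` sites. -/
def HasDimension (G : SimpleGraph Λ) (D C₀ : ℝ) : Prop :=
  ∀ m : Λ, ∀ r : ℕ, 1 ≤ r → ({l : Λ | G.dist l m = r}.ncard : ℝ) ≤ C₀ * (r : ℝ) ^ (D - 1)

/-- A connected lattice of dimension `D`, with couplings bounded by the given constants and
an interaction of range `r₀`. -/
structure Model.IsAdmissible (M : Model Λ) (D C₀ tmax Vmax Bmax : ℝ) (r₀ : ℕ) : Prop where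
  connected : M.graph.Connected
  dimension : HasDimension M.graph D C₀
  hop_le : ∀ i j, M.graph.Adj i j → ‖M.hop i j‖ ≤ tmax
  finiteRange : IsFiniteRange M.graph M.interaction r₀ Vmax
  field_le : ∀ i a, |M.field i a| ≤ Bmax

/-! ### Sectors, ground states, expectations -/

/-- The subspace of the Fock space on which the operator `A` has the value `a`. -/
def eigenspaceOf (A : Op Λ) (a : ℂ) : Submodule ℂ (Fock Λ) :=
  Module.End.eigenspace (Matrix.toEuclideanLin A) a

variable (Λ) in
/-- The subspace of particle number `N`. -/
def numberSector (N : ℕ) : Submodule ℂ (Fock Λ) := eigenspaceOf (totalNumber Λ) (N : ℂ)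

variable (Λ) in
/-- The subspace of particle number `N` and total magnetization `M`. -/
def numberSpinSector (N : ℕ) (M : ℝ) : Submodule ℂ (Fock Λ) :=
  numberSector Λ N ⊓ eigenspaceOf (totalSpinZ Λ) (M : ℂ)

/-- The eigenvalues of the restriction of `H` to the (`H`-invariant) subspace `K`. -/
def spectrumOn (H : Op Λ) (K : Submodule ℂ (Fock Λ)) : Set ℝ :=
  {E | K ⊓ eigenspaceOf H (E : ℂ) ≠ ⊥}

/-- `σ₀` is a nonempty set of eigenvalues at the bottom of the spectrum of `H` on `K`, and the rest
of that spectrum lies above it by more than `ΔE`. -/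
structure IsGroundSector (H : Op Λ) (K : Submodule ℂ (Fock Λ)) (σ₀ : Finset ℝ) (ΔE : ℝ) :
    Prop where
  nonempty : σ₀.Nonempty
  subset : ∀ E ∈ σ₀, E ∈ spectrumOn H K
  gap : ∀ E ∈ σ₀, ∀ E' ∈ spectrumOn H K, E' ∉ σ₀ → ΔE < E' - E

/-- The span of the eigenvectors of `H` in `K` with eigenvalues in `σ₀`. -/
def groundSpace (H : Op Λ) (K : Submodule ℂ (Fock Λ)) (σ₀ : Finset ℝ) : Submodule ℂ (Fock Λ) :=
  ⨆ E ∈ σ₀, K ⊓ eigenspaceOf H (E : ℂ)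

/-- The expectation `q⁻¹ Tr (A P₀)`, where `P₀` is the orthogonal projection onto the
ground-state space and `q` is the dimension of that space. -/
def groundExpectation (H : Op Λ) (K : Submodule ℂ (Fock Λ)) (σ₀ : Finset ℝ) (A : Op Λ) : ℂ :=
  (Module.finrank ℂ (groundSpace H K σ₀) : ℂ)⁻¹ *
    LinearMap.trace ℂ (Fock Λ)
      (Matrix.toEuclideanLin A ∘ₗ ((groundSpace H K σ₀).starProjection : Fock Λ →ₗ[ℂ] Fock Λ))

/-- A uniform gap `ΔE` along a sequence of Hamiltonians: the eigenvalues in the ground-state sector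
`σ₀ k` are separated from the rest of the spectrum by more than `ΔE`, and the largest difference
of two of them tends to `0`. -/
def HasUniformGap {Λ : ℕ → Type} [∀ k, Fintype (Λ k)] [∀ k, LinearOrder (Λ k)]
    (H : ∀ k, Op (Λ k)) (K : ∀ k, Submodule ℂ (Fock (Λ k))) (σ₀ : ℕ → Finset ℝ) (ΔE : ℝ) : Prop :=
  (∀ k, IsGroundSector (H k) (K k) (σ₀ k) ΔE) ∧
    Tendsto (fun k => Metric.diam (σ₀ k : Set ℝ)) atTop (𝓝 0)

/-- The bound `|⟨A m n⟩| ≤ C exp(-γ dist(m,n)^(1-D/2))` in the limit `k → ∞`: for every `R` it holds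
in all sufficiently large volumes, for all sites `m`, `n` at distance at most `R`. -/
def DecaysInLimit {Λ : ℕ → Type} [∀ k, Fintype (Λ k)] [∀ k, LinearOrder (Λ k)]
    (M : ∀ k, Model (Λ k)) (K : ∀ k, Submodule ℂ (Fock (Λ k))) (σ₀ : ℕ → Finset ℝ)
    (A : ∀ k, Λ k → Λ k → Op (Λ k)) (D C γ : ℝ) : Prop :=
  ∀ R : ℕ, ∀ᶠ k in atTop, ∀ m n : Λ k, (M k).graph.dist m n ≤ R →
    ‖groundExpectation (M k).hamiltonian (K k) (σ₀ k) (A k m n)‖ ≤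
      C * Real.exp (-γ * ((M k).graph.dist m n : ℝ) ^ (1 - D / 2))

end LatticeElectron

end

/-! The proof twists the Hamiltonian by a slowly varying imaginary gauge transformation. Let `Q = ∑
φ x n_x` and `G = exp (-Q)`, where `φ` falls linearly from `m` with slope `β r ^ (-D/2)` and
vanishes at distance `r = dist(m,n)`. An observable that moves charge from `n` to `m` satisfies `G A
G⁻¹ = exp (-a) A` with `a` proportional to `β r ^ (1 - D/2)`. By cyclicity `Tr (A P₀) = exp (-a) Tr
(G P₀ G⁻¹ A)`. The last operator has rank at most `q`, so it suffices to bound `G P₀ G⁻¹` uniformly,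
whatever the degeneracy.

Terms local in the sites commute with `Q`, so `G H G⁻¹ = H + [H, Q] + R`, where `R` and `[Q, [H,
Q]]` are quadratic in the increments of `φ`. About `r ^ D` bonds with squared increment `β² r ^
(-D)` make both of order `β²`, small against the gap (`sum_tent_sub_sq_le`). The first-order term
`[H, Q]` need not be small in norm. It is antisymmetric, and its matrix element between the ground
space and its complement is controlled by positivity of `H`, measured from the ground energy, at the
trial vector `w + Q p`; this costs only a double commutator (`norm_sub_starProjection_le_of_gap`).
Hence `G` and `G⁻¹` nearly preserve the ground space, and `norm_oblique_projection_le` gives the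
bound `3`.

The width of the ground sector enters multiplied by norms of `Q` and `G`. For `r ≤ R` these norms
are bounded independently of the volume, so the vanishing width wins in the limit. -/

set_option linter.unusedSectionVars false

noncomputable section

namespace LatticeElectron

/-! ### Abstract gap estimates on a finite-dimensional Hilbert space. -/

section Hilbert

open scoped InnerProductSpace

variable {E : Type*} [NormedAddCommGroup E] [InnerProductSpace ℂ E] [FiniteDimensional ℂ E]

/-- If `G H = (H + [H, Q] + R) G` with `R` and `[Q, [H, Q]]` small compared to the gap `ΔE`,
then `G` maps the ground space `V` close to itself. -/
theorem norm_sub_starProjection_le_of_gap {K V : Submodule ℂ E} (hVK : V ≤ K)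
    (H Q G R : E →ₗ[ℂ] E) {ΔE δ L g ε : ℝ} (hΔE : 0 < ΔE) (hδ : 0 ≤ δ) (hL : 0 ≤ L)
    (hH : H.IsSymmetric) (hQ : Q.IsSymmetric)
    (hQK : ∀ x ∈ K, Q x ∈ K) (hGK : ∀ x ∈ K, G x ∈ K)
    (hHV : ∀ x ∈ V, H x ∈ V)
    (hpos : ∀ x ∈ K, 0 ≤ (⟪x, H x⟫_ℂ).re)
    (hgap : ∀ x ∈ K, x ∈ Vᗮ → ΔE * ‖x‖ ^ 2 ≤ (⟪x, H x⟫_ℂ).re)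
    (hsmall : ∀ x ∈ V, ‖H x‖ ≤ δ * ‖x‖)
    (hconj : ∀ x, G (H x) = H (G x) + (H (Q (G x)) - Q (H (G x))) + R (G x))
    (hR : ∀ x, ‖R x‖ ≤ ε * ‖x‖)
    (hD : ∀ x, 2 * (⟪Q x, H (Q x)⟫_ℂ).re - 2 * (⟪Q (Q x), H x⟫_ℂ).re ≤ ε * ‖x‖ ^ 2)
    (hQL : ∀ x, ‖Q x‖ ≤ L * ‖x‖) (hg : 0 ≤ g) (hGg : ∀ x, ‖G x‖ ≤ g * ‖x‖)
    (hGg' : ∀ x, ‖x‖ ≤ g * ‖G x‖)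
    (hε : ε ≤ ΔE / 64) (h1 : L * δ ≤ ΔE / 128) (h2 : L ^ 2 * δ ≤ ΔE / 128)
    (h3 : g ^ 2 * δ ≤ ΔE / 128) {v : E} (hv : v ∈ V) :
    ‖G v - V.starProjection (G v)‖ ≤ 1 / 2 * ‖V.starProjection (G v)‖ := by
  set u := G v with hu
  set p := V.starProjection u with hp
  set w := u - p with hw
  have hpV : p ∈ V := V.starProjection_apply_mem u
  have hwV : w ∈ Vᗮ := V.sub_starProjection_mem_orthogonal u
  have huK : u ∈ K := hGK v (hVK hv)
  have hwK : w ∈ K := K.sub_mem huK (hVK hpV)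
  have hupw : u = w + p := by simp [hw]
  -- the eigenvalue equation for `u`
  have hr : ‖G (H v)‖ ≤ ΔE / 128 * ‖u‖ := by
    calc ‖G (H v)‖ ≤ g * ‖H v‖ := hGg _
      _ ≤ g * (δ * (g * ‖u‖)) := by
        gcongr
        exact (hsmall v hv).trans (mul_le_mul_of_nonneg_left (hGg' v) hδ)
      _ = g ^ 2 * δ * ‖u‖ := by ring
      _ ≤ _ := by gcongr
  have heq := congrArg (fun y => (⟪w, y⟫_ℂ).re) (hconj v)
  simp only [← hu] at heq
  rw [hupw] at heq
  simp only [map_add, inner_add_right, inner_sub_right, Complex.add_re, Complex.sub_re] at heq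
  have e1 : (⟪w, H p⟫_ℂ).re = 0 := by
    rw [(Submodule.mem_orthogonal' V w).1 hwV _ (hHV p hpV)]; rfl
  -- The commutator of two symmetric maps is antisymmetric, so its form at `w` has no real part;
  -- only the cross terms between `w` and `p` survive.
  have e2 : (⟪w, Q (H w)⟫_ℂ).re = (⟪w, H (Q w)⟫_ℂ).re := by
    rw [← hQ w, ← hH, ← inner_conj_symm, Complex.conj_re]
  have e3 : |(⟪w, Q (H p)⟫_ℂ).re| ≤ ΔE / 128 * ‖w‖ * ‖p‖ := by
    calc _ ≤ ‖⟪w, Q (H p)⟫_ℂ‖ := Complex.abs_re_le_norm _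
      _ ≤ ‖w‖ * ‖Q (H p)‖ := norm_inner_le_norm _ _
      _ ≤ ‖w‖ * (L * (δ * ‖p‖)) := by
        gcongr
        exact (hQL _).trans (mul_le_mul_of_nonneg_left (hsmall p hpV) hL)
      _ = L * δ * (‖w‖ * ‖p‖) := by ring
      _ ≤ ΔE / 128 * (‖w‖ * ‖p‖) := by gcongr
      _ = _ := by ring
  have hu' : ‖u‖ ≤ ‖w‖ + ‖p‖ := by rw [hupw]; exact norm_add_le _ _
  have e4 : |(⟪w, R w⟫_ℂ).re + (⟪w, R p⟫_ℂ).re| ≤ ΔE / 64 * ‖w‖ * (‖w‖ + ‖p‖) := by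
    rw [← Complex.add_re, ← inner_add_right, ← map_add, ← hupw]
    calc _ ≤ ‖⟪w, R u⟫_ℂ‖ := Complex.abs_re_le_norm _
      _ ≤ ‖w‖ * ‖R u‖ := norm_inner_le_norm _ _
      _ ≤ ‖w‖ * (ΔE / 64 * (‖w‖ + ‖p‖)) := by
        gcongr
        refine (hR u).trans ?_
        gcongr
      _ = _ := by ring
  have e5 : |(⟪w, G (H v)⟫_ℂ).re| ≤ ΔE / 128 * ‖w‖ * (‖w‖ + ‖p‖) := by
    calc _ ≤ ‖⟪w, G (H v)⟫_ℂ‖ := Complex.abs_re_le_norm _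
      _ ≤ ‖w‖ * ‖G (H v)‖ := norm_inner_le_norm _ _
      _ ≤ ‖w‖ * (ΔE / 128 * (‖w‖ + ‖p‖)) := by
        gcongr
        exact hr.trans (by gcongr)
      _ = _ := by ring
  -- the form of `H` at `w + Q p`
  have e6 := hpos (w + Q p) (K.add_mem hwK (hQK p (hVK hpV)))
  simp only [map_add, inner_add_right, inner_add_left, Complex.add_re] at e6
  have e7 : (⟪Q p, H w⟫_ℂ).re = (⟪w, H (Q p)⟫_ℂ).re := by
    rw [← hH, ← inner_conj_symm, Complex.conj_re]
  have e8 : |(⟪Q (Q p), H p⟫_ℂ).re| ≤ ΔE / 128 * ‖p‖ ^ 2 := by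
    calc _ ≤ ‖⟪Q (Q p), H p⟫_ℂ‖ := Complex.abs_re_le_norm _
      _ ≤ ‖Q (Q p)‖ * ‖H p‖ := norm_inner_le_norm _ _
      _ ≤ (L * (L * ‖p‖)) * (δ * ‖p‖) := by
        gcongr
        · exact (hQL _).trans (mul_le_mul_of_nonneg_left (hQL p) hL)
        · exact hsmall p hpV
      _ = L ^ 2 * δ * ‖p‖ ^ 2 := by ring
      _ ≤ _ := by gcongr
  have e9 := hD p
  have e10 : ε * ‖p‖ ^ 2 ≤ ΔE / 64 * ‖p‖ ^ 2 := by gcongr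
  have e11 := hgap w hwK hwV
  rw [abs_le] at e3 e4 e5 e8
  -- Up to small terms `heq` reads `⟨w, H w⟩ + Re ⟨w, H Q p⟩ = 0`. Positivity `e6` gives `Re ⟨w, H Q
  -- p⟩ ≥ -⟨w, H w⟩ / 2 - ⟨Q p, H Q p⟩ / 2`, and `e9` with `e8` makes the last form small. Half of
  -- `⟨w, H w⟩` remains, to which the gap applies.
  have key : ΔE * (‖w‖ ^ 2 / 2) ≤
      ΔE * (‖p‖ ^ 2 / 64 + ‖w‖ * ‖p‖ / 128 + 3 / 128 * ‖w‖ * (‖w‖ + ‖p‖)) := by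
    linarith [e3.1, e3.2, e4.1, e4.2, e5.1, e5.2, e8.1, e8.2]
  have key' := le_of_mul_le_mul_left key hΔE
  by_contra! hcon
  nlinarith [norm_nonneg w, norm_nonneg p]

/-- The oblique projection `G P₀ G⁻¹` is bounded by `3` if `G` and `G⁻¹` map the range `V` of `P₀`
close to itself. -/
theorem norm_oblique_projection_le {V : Submodule ℂ E} (G G' : E →ₗ[ℂ] E)
    (hG : G.IsSymmetric) (hG' : G'.IsSymmetric) (hGG' : ∀ x, G (G' x) = x)
    (h : ∀ v ∈ V, ‖G v - V.starProjection (G v)‖ ≤ 1 / 2 * ‖V.starProjection (G v)‖)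
    (h' : ∀ v ∈ V, ‖G' v - V.starProjection (G' v)‖ ≤ 1 / 2 * ‖V.starProjection (G' v)‖)
    (x : E) : ‖G (V.starProjection (G' x))‖ ≤ 3 * ‖x‖ := by
  set y := G (V.starProjection (G' x)) with hy
  set p := V.starProjection y with hp
  have hpV : p ∈ V := V.starProjection_apply_mem y
  have hyp : ‖y - p‖ ≤ 1 / 2 * ‖p‖ := h _ (V.starProjection_apply_mem _)
  have hG'inj : ∀ z, G' z = 0 → z = 0 := by
    intro z hz
    rw [← hGG' z, hz, map_zero]
  -- The compression of `G'` to `V` is injective, since a vector of `G' V` with zero projection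
  -- vanishes by `h'`; in finite dimension it is then onto.
  obtain ⟨v', hv'V, hv'⟩ : ∃ v' ∈ V, V.starProjection (G' v') = p := by
    let F : V →ₗ[ℂ] V := V.orthogonalProjectionOnto.toLinearMap ∘ₗ G' ∘ₗ V.subtype
    have hF : Function.Injective F := by
      rw [← LinearMap.ker_eq_bot, LinearMap.ker_eq_bot']
      intro z hz
      have hz0 : V.starProjection (G' z) = 0 := by
        rw [Submodule.starProjection_apply]
        exact congrArg Subtype.val hz
      have := h' z z.2
      rw [hz0, sub_zero, norm_zero, mul_zero] at this
      have := hG'inj _ (norm_le_zero_iff.1 this)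
      exact Subtype.ext this
    obtain ⟨z, hz⟩ := (LinearMap.injective_iff_surjective.1 hF) ⟨p, hpV⟩
    refine ⟨z, z.2, ?_⟩
    rw [Submodule.starProjection_apply]
    exact congrArg Subtype.val hz
  set w' := G' v' with hw'
  have hw'p : ‖w' - p‖ ≤ 1 / 2 * ‖p‖ := by
    have := h' v' hv'V
    rwa [hv'] at this
  -- Testing against `G' V` removes the oblique projection: `G` moves to the left and cancels `G'`,
  -- and `P₀` fixes `v'`.
  have hin : ⟪w', y⟫_ℂ = ⟪w', x⟫_ℂ := by
    rw [hy, ← hG, hw', hGG', ← Submodule.inner_starProjection_left_eq_right,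
      Submodule.starProjection_eq_self_iff.2 hv'V, hG']
  have hdec : ⟪w', y⟫_ℂ = ⟪p, p⟫_ℂ + ⟪w' - p, y - p⟫_ℂ := by
    have a1 : ⟪p, y - p⟫_ℂ = 0 :=
      (Submodule.mem_orthogonal V _).1 (V.sub_starProjection_mem_orthogonal y) _ hpV
    have a2 : ⟪w' - p, p⟫_ℂ = 0 := by
      rw [← hv']
      exact (Submodule.mem_orthogonal' V _).1 (V.sub_starProjection_mem_orthogonal w') _
        (V.starProjection_apply_mem w')
    have : ⟪w', y⟫_ℂ = ⟪(w' - p) + p, (y - p) + p⟫_ℂ := by simp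
    rw [this, inner_add_left, inner_add_right, inner_add_right, a1, a2]
    ring
  have hlow : ‖p‖ ^ 2 ≤ ‖w'‖ * ‖x‖ + ‖w' - p‖ * ‖y - p‖ := by
    have b1 : ⟪p, p⟫_ℂ = ⟪w', x⟫_ℂ - ⟪w' - p, y - p⟫_ℂ := by rw [← hin, hdec]; ring
    have b2 := congrArg norm b1
    rw [inner_self_eq_norm_sq_to_K] at b2
    have b3 : ‖((‖p‖ : ℂ)) ^ 2‖ = ‖p‖ ^ 2 := by simp
    calc ‖p‖ ^ 2 = ‖⟪w', x⟫_ℂ - ⟪w' - p, y - p⟫_ℂ‖ := by rw [← b3]; exact b2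
      _ ≤ _ := (norm_sub_le _ _).trans
        (add_le_add (norm_inner_le_norm _ _) (norm_inner_le_norm _ _))
  have hw'n : ‖w'‖ ≤ 3 / 2 * ‖p‖ := by
    have := norm_add_le (w' - p) p
    rw [sub_add_cancel] at this
    linarith
  have hyn : ‖y‖ ≤ 3 / 2 * ‖p‖ := by
    have := norm_add_le (y - p) p
    rw [sub_add_cancel] at this
    linarith
  have hprod : ‖w' - p‖ * ‖y - p‖ ≤ (1 / 2 * ‖p‖) * (1 / 2 * ‖p‖) := by gcongr
  have hprod' : ‖w'‖ * ‖x‖ ≤ (3 / 2 * ‖p‖) * ‖x‖ := by gcongr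
  -- `‖p‖² ≤ (3/2) ‖p‖ ‖x‖ + (1/4) ‖p‖²`; together with `hyn` this produces the constant `3 = (3/2)
  -- * 2`.
  have hp2 : ‖p‖ ≤ 2 * ‖x‖ := by
    by_contra! hc
    nlinarith [norm_nonneg x, norm_nonneg p]
  linarith

/-- An operator of norm at most `c` with range in `W` has trace at most `c * dim W`. -/
theorem norm_trace_le_of_range_le {W : Submodule ℂ E} (Y : E →ₗ[ℂ] E) (hY : ∀ x, Y x ∈ W)
    {c : ℝ} (hc : ∀ x, ‖Y x‖ ≤ c * ‖x‖) :
    ‖LinearMap.trace ℂ E Y‖ ≤ c * Module.finrank ℂ W := by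
  rw [← LinearMap.trace_restrict_eq_of_forall_mem W Y hY,
    LinearMap.trace_eq_sum_inner _ (stdOrthonormalBasis ℂ W)]
  refine (norm_sum_le _ _).trans ?_
  have : ∀ i ∈ Finset.univ, ‖⟪stdOrthonormalBasis ℂ W i,
      Y.restrict (fun x (_ : x ∈ W) => hY x) (stdOrthonormalBasis ℂ W i)⟫_ℂ‖ ≤ c := by
    intro i _
    refine (norm_inner_le_norm _ _).trans ?_
    have h1 : ‖stdOrthonormalBasis ℂ W i‖ = 1 := (stdOrthonormalBasis ℂ W).norm_eq_one i
    rw [h1, one_mul]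
    refine (hc _).trans ?_
    rw [Submodule.subtype_apply, Submodule.norm_coe, h1, mul_one]
  refine (Finset.sum_le_card_nsmul _ _ _ this).trans ?_
  simp [mul_comm]

/-- If conjugation with `G = G'⁻¹` multiplies `A` by `exp (-a)`, then the trace of `A` over the range
of a projection is controlled by the oblique projection `G P₀ G⁻¹`. -/
theorem norm_trace_comp_starProjection_le {V : Submodule ℂ E} (A G G' : E →ₗ[ℂ] E) {a c : ℝ}
    (hc : 0 ≤ c) (hGG' : ∀ x, G (G' x) = x) (hG'G : ∀ x, G' (G x) = x)
    (hA : ∀ x, G (A (G' x)) = (Real.exp (-a) : ℂ) • A x) (hAc : ∀ x, ‖A x‖ ≤ c * ‖x‖)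
    (hP : ∀ x, ‖G (V.starProjection (G' x))‖ ≤ 3 * ‖x‖) :
    ‖LinearMap.trace ℂ E (A ∘ₗ (V.starProjection : E →ₗ[ℂ] E))‖ ≤
      3 * c * Real.exp (-a) * Module.finrank ℂ V := by
  set P : E →ₗ[ℂ] E := (V.starProjection : E →ₗ[ℂ] E) with hPdef
  have hGG : G ∘ₗ G' = LinearMap.id := LinearMap.ext hGG'
  have hGG2 : G' ∘ₗ G = LinearMap.id := LinearMap.ext hG'G
  have hA' : G ∘ₗ A ∘ₗ G' = (Real.exp (-a) : ℂ) • A := LinearMap.ext hA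
  have h1 : LinearMap.trace ℂ E (A ∘ₗ P) =
      (Real.exp (-a) : ℂ) * LinearMap.trace ℂ E ((G ∘ₗ P ∘ₗ G') ∘ₗ A) := by
    calc LinearMap.trace ℂ E (A ∘ₗ P)
        = LinearMap.trace ℂ E ((G' ∘ₗ G) ∘ₗ (A ∘ₗ P)) := by rw [hGG2, LinearMap.id_comp]
      _ = LinearMap.trace ℂ E (G' ∘ₗ (G ∘ₗ A ∘ₗ P)) := by simp only [LinearMap.comp_assoc]
      _ = LinearMap.trace ℂ E ((G ∘ₗ A ∘ₗ P) ∘ₗ G') := LinearMap.trace_comp_comm' _ _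
      _ = LinearMap.trace ℂ E ((G ∘ₗ A ∘ₗ G') ∘ₗ (G ∘ₗ P ∘ₗ G')) := by
        congr 1
        ext x
        simp [hG'G]
      _ = _ := by
        rw [hA', LinearMap.smul_comp, map_smul, smul_eq_mul, LinearMap.trace_comp_comm']
  -- The range lies in `G V`, whose dimension is at most `q`; the full Fock dimension never enters.
  have h2 := norm_trace_le_of_range_le (W := V.map G) ((G ∘ₗ P ∘ₗ G') ∘ₗ A) (c := 3 * c)
    (fun x => Submodule.mem_map_of_mem (V.starProjection_apply_mem _))
    (fun x => (hP _).trans (by nlinarith [hAc x]))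
  have h3 : (Module.finrank ℂ (V.map G) : ℝ) ≤ Module.finrank ℂ V := by
    exact_mod_cast Submodule.finrank_map_le G V
  rw [h1, norm_mul, Complex.norm_real, Real.norm_of_nonneg (Real.exp_pos _).le]
  calc _ ≤ Real.exp (-a) * (3 * c * Module.finrank ℂ (V.map G)) := by gcongr
    _ ≤ Real.exp (-a) * (3 * c * Module.finrank ℂ V) := by gcongr
    _ = _ := by ring

theorem re_inner_apply_eq_sum {F : Type*} [NormedAddCommGroup F] [InnerProductSpace ℂ F]
    {ι : Type*} [Fintype ι] (b : OrthonormalBasis ι ℂ F) (T : F →ₗ[ℂ] F) (hT : T.IsSymmetric)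
    (l : ι → ℝ) (hl : ∀ i, T (b i) = (l i : ℂ) • b i) (x : F) :
    (⟪x, T x⟫_ℂ).re = ∑ i, l i * ‖⟪b i, x⟫_ℂ‖ ^ 2 := by
  rw [← b.sum_inner_mul_inner x (T x), Complex.re_sum]
  refine Finset.sum_congr rfl fun i _ => ?_
  rw [← hT, hl, inner_smul_left, Complex.conj_ofReal, ← inner_conj_symm x (b i), mul_left_comm,
    ← Complex.normSq_eq_conj_mul_self, Complex.normSq_eq_norm_sq, ← Complex.ofReal_mul,
    Complex.ofReal_re]

/-- Spectral bounds for a symmetric operator on an invariant subspace `K` whose spectrum there has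
a bottom part `σ₀` separated by a gap from the rest. -/
theorem spectral_bounds_of_gap {K : Submodule ℂ E} (H : E →ₗ[ℂ] E) (hH : H.IsSymmetric)
    (hHK : ∀ x ∈ K, H x ∈ K) {σ₀ : Finset ℝ} {ΔE : ℝ} (hΔE : 0 < ΔE) (hσ : σ₀.Nonempty)
    (hgap : ∀ e ∈ σ₀, ∀ e' : ℝ, K ⊓ Module.End.eigenspace H (e' : ℂ) ≠ ⊥ → e' ∉ σ₀ →
      ΔE < e' - e) :
    (∀ x ∈ K, σ₀.min' hσ * ‖x‖ ^ 2 ≤ (⟪x, H x⟫_ℂ).re) ∧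
    (∀ x ∈ K, x ∈ (⨆ e ∈ σ₀, K ⊓ Module.End.eigenspace H ((e : ℝ) : ℂ))ᗮ →
      (σ₀.min' hσ + ΔE) * ‖x‖ ^ 2 ≤ (⟪x, H x⟫_ℂ).re) ∧
    (∀ x ∈ ⨆ e ∈ σ₀, K ⊓ Module.End.eigenspace H ((e : ℝ) : ℂ),
      ‖H x - (σ₀.min' hσ : ℂ) • x‖ ≤ Metric.diam (σ₀ : Set ℝ) * ‖x‖) := by
  set V : Submodule ℂ E := ⨆ e ∈ σ₀, K ⊓ Module.End.eigenspace H ((e : ℝ) : ℂ) with hV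
  set e₀ := σ₀.min' hσ with he₀
  have he₀m : e₀ ∈ σ₀ := σ₀.min'_mem hσ
  have hT := hH.restrict_invariant hHK
  set T := H.restrict hHK with hTdef
  -- All three bounds are read off termwise in an eigenbasis of the restriction of `H` to `K`.
  set b := hT.eigenvectorBasis rfl with hb
  set l := hT.eigenvalues rfl with hl
  have hTb : ∀ i, T (b i) = (l i : ℂ) • b i := fun i => hT.apply_eigenvectorBasis rfl i
  have hHb : ∀ i, H (b i : E) = (l i : ℂ) • (b i : E) := fun i => congrArg Subtype.val (hTb i)
  have hbK : ∀ i, (b i : E) ∈ K ⊓ Module.End.eigenspace H (l i : ℂ) := fun i =>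
    ⟨(b i).2, Module.End.mem_eigenspace_iff.2 (hHb i)⟩
  have hb0 : ∀ i, (b i : E) ≠ 0 := fun i h => by
    have h1 := b.norm_eq_one i
    rw [← Submodule.norm_coe, h, norm_zero] at h1
    exact zero_ne_one h1
  have hspec : ∀ i, K ⊓ Module.End.eigenspace H (l i : ℂ) ≠ ⊥ := fun i h =>
    hb0 i ((Submodule.eq_bot_iff _).1 h _ (hbK i))
  have hform : ∀ x (hx : x ∈ K), (⟪x, H x⟫_ℂ).re = ∑ i, l i * ‖⟪(b i : E), x⟫_ℂ‖ ^ 2 :=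
    fun x hx => re_inner_apply_eq_sum b T hT l hTb ⟨x, hx⟩
  have hnorm : ∀ x (hx : x ∈ K), ‖x‖ ^ 2 = ∑ i, ‖⟪(b i : E), x⟫_ℂ‖ ^ 2 :=
    fun x hx => (b.sum_sq_norm_inner_right ⟨x, hx⟩).symm
  have hlow : ∀ i, e₀ ≤ l i := fun i => by
    by_cases hi : l i ∈ σ₀
    · exact σ₀.min'_le _ hi
    · linarith [hgap e₀ he₀m (l i) (hspec i) hi]
  have hbV : ∀ i, l i ∈ σ₀ → (b i : E) ∈ V := fun i hi =>
    Submodule.mem_iSup_of_mem (l i) (Submodule.mem_iSup_of_mem hi (hbK i))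
  have hVK : V ≤ K := iSup₂_le fun _ _ => inf_le_left
  have hVb : ∀ i, l i ∉ σ₀ → ∀ x ∈ V, ⟪(b i : E), x⟫_ℂ = 0 := by
    intro i hi x hx
    have : V ≤ (ℂ ∙ (b i : E))ᗮ := by
      refine iSup₂_le fun e he y hy => ?_
      rw [Submodule.mem_orthogonal_singleton_iff_inner_right]
      have h1 : H y = (e : ℂ) • y := Module.End.mem_eigenspace_iff.1 hy.2
      have h2 := hH (b i : E) y
      rw [hHb, h1, inner_smul_left, inner_smul_right, Complex.conj_ofReal, ← sub_eq_zero,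
        ← sub_mul] at h2
      refine (mul_eq_zero.1 h2).resolve_left fun h3 => hi ?_
      rw [← Complex.ofReal_sub, Complex.ofReal_eq_zero, sub_eq_zero] at h3
      exact h3 ▸ he
    exact Submodule.mem_orthogonal_singleton_iff_inner_right.1 (this hx)
  refine ⟨fun x hx => ?_, fun x hx hxV => ?_, fun x hx => ?_⟩
  · rw [hform x hx, hnorm x hx, Finset.mul_sum]
    gcongr with i
    exact hlow i
  · rw [hform x hx, hnorm x hx, Finset.mul_sum]
    refine Finset.sum_le_sum fun i _ => ?_
    by_cases hi : l i ∈ σ₀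
    · rw [(Submodule.mem_orthogonal V x).1 hxV _ (hbV i hi)]
      simp
    · have := hgap e₀ he₀m (l i) (hspec i) hi
      gcongr
      linarith
  · have hxK := hVK hx
    have hyK : H x - (e₀ : ℂ) • x ∈ K := K.sub_mem (hHK x hxK) (K.smul_mem _ hxK)
    refine le_of_sq_le_sq ?_ (mul_nonneg Metric.diam_nonneg (norm_nonneg _))
    rw [mul_pow, hnorm _ hyK, hnorm x hxK, Finset.mul_sum]
    refine Finset.sum_le_sum fun i _ => ?_
    have h1 : ⟪(b i : E), H x - (e₀ : ℂ) • x⟫_ℂ = ((l i - e₀ : ℝ) : ℂ) * ⟪(b i : E), x⟫_ℂ := by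
      rw [inner_sub_right, ← hH, hHb, inner_smul_left, inner_smul_right, Complex.conj_ofReal]
      push_cast
      ring
    by_cases hi : l i ∈ σ₀
    · rw [h1, norm_mul, mul_pow, Complex.norm_real, ← dist_eq_norm]
      gcongr
      exact Metric.dist_le_diam_of_mem σ₀.finite_toSet.isBounded hi he₀m
    · rw [h1, hVb i hi x hx]
      simp

/-- Exponential bound on the expectation in the ground space of an operator `A` whose charge with
respect to `Q` is `a`; `G` and `G'` play the role of `exp (-Q)` and `exp Q`. -/
theorem norm_trace_ground_le_exp {K : Submodule ℂ E} (H Q G G' R R' A : E →ₗ[ℂ] E)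
    (hH : H.IsSymmetric) (hQ : Q.IsSymmetric) (hG : G.IsSymmetric) (hG' : G'.IsSymmetric)
    (hHK : ∀ x ∈ K, H x ∈ K) (hQK : ∀ x ∈ K, Q x ∈ K) (hGK : ∀ x ∈ K, G x ∈ K)
    (hGK' : ∀ x ∈ K, G' x ∈ K)
    {σ₀ : Finset ℝ} {ΔE ε L g a c : ℝ} (hΔE : 0 < ΔE) (hσ : σ₀.Nonempty)
    (hgap : ∀ e ∈ σ₀, ∀ e' : ℝ, K ⊓ Module.End.eigenspace H (e' : ℂ) ≠ ⊥ → e' ∉ σ₀ →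
      ΔE < e' - e)
    (hGG' : ∀ x, G (G' x) = x) (hG'G : ∀ x, G' (G x) = x)
    (hconj : ∀ x, G (H x) = H (G x) + (H (Q (G x)) - Q (H (G x))) + R (G x))
    (hconj' : ∀ x, G' (H x) = H (G' x) - (H (Q (G' x)) - Q (H (G' x))) + R' (G' x))
    (hR : ∀ x, ‖R x‖ ≤ ε * ‖x‖) (hR' : ∀ x, ‖R' x‖ ≤ ε * ‖x‖)
    (hD : ∀ x, 2 * (⟪Q x, H (Q x)⟫_ℂ).re - 2 * (⟪Q (Q x), H x⟫_ℂ).re ≤ ε * ‖x‖ ^ 2)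
    (hL : 0 ≤ L) (hQL : ∀ x, ‖Q x‖ ≤ L * ‖x‖) (hg : 0 ≤ g)
    (hGg : ∀ x, ‖G x‖ ≤ g * ‖x‖) (hGg' : ∀ x, ‖G' x‖ ≤ g * ‖x‖)
    (hε : ε ≤ ΔE / 64) (h1 : L * Metric.diam (σ₀ : Set ℝ) ≤ ΔE / 128)
    (h2 : L ^ 2 * Metric.diam (σ₀ : Set ℝ) ≤ ΔE / 128)
    (h3 : g ^ 2 * Metric.diam (σ₀ : Set ℝ) ≤ ΔE / 128)
    (hA : ∀ x, G (A (G' x)) = (Real.exp (-a) : ℂ) • A x) (hc : 0 ≤ c)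
    (hAc : ∀ x, ‖A x‖ ≤ c * ‖x‖) :
    ‖LinearMap.trace ℂ E (A ∘ₗ ((⨆ e ∈ σ₀, K ⊓
        Module.End.eigenspace H ((e : ℝ) : ℂ)).starProjection : E →ₗ[ℂ] E))‖ ≤
      3 * c * Real.exp (-a) * Module.finrank ℂ (⨆ e ∈ σ₀, K ⊓
        Module.End.eigenspace H ((e : ℝ) : ℂ) : Submodule ℂ E) := by
  obtain ⟨s1, s2, s3⟩ := spectral_bounds_of_gap H hH hHK hΔE hσ hgap
  set V : Submodule ℂ E := ⨆ e ∈ σ₀, K ⊓ Module.End.eigenspace H ((e : ℝ) : ℂ) with hV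
  set e₀ := σ₀.min' hσ
  have hVK : V ≤ K := iSup₂_le fun _ _ => inf_le_left
  have hHV : ∀ x ∈ V, H x ∈ V := by
    have : V ≤ V.comap H := iSup₂_le fun e he y hy => by
      have hy' : H y = (e : ℂ) • y := Module.End.mem_eigenspace_iff.1 hy.2
      rw [Submodule.mem_comap, hy']
      exact V.smul_mem _ (Submodule.mem_iSup_of_mem e (Submodule.mem_iSup_of_mem he hy))
    exact this
  -- Energies are measured from the lowest one. The shift drops out of every commutator, and out of
  -- `hD` because `⟨Q x, Q x⟩ = ⟨Q² x, x⟩`.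
  set H₀ : E →ₗ[ℂ] E := H - (e₀ : ℂ) • LinearMap.id with hH₀
  have hH₀x : ∀ x, H₀ x = H x - (e₀ : ℂ) • x := fun x => by simp [hH₀]
  have hre : ∀ x y, (⟪x, H₀ y⟫_ℂ).re = (⟪x, H y⟫_ℂ).re - e₀ * (⟪x, y⟫_ℂ).re := fun x y => by
    rw [hH₀x, inner_sub_right, inner_smul_right, Complex.sub_re, Complex.re_ofReal_mul]
  have hre' : ∀ x, (⟪x, H₀ x⟫_ℂ).re = (⟪x, H x⟫_ℂ).re - e₀ * ‖x‖ ^ 2 := fun x => by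
    rw [hre, inner_self_eq_norm_sq_to_K]
    norm_cast
  have hH₀s : H₀.IsSymmetric := fun x y => by
    rw [hH₀x, hH₀x, inner_sub_left, inner_sub_right, hH, inner_smul_left, inner_smul_right,
      Complex.conj_ofReal]
  have hD₀ : ∀ x, 2 * (⟪Q x, H₀ (Q x)⟫_ℂ).re - 2 * (⟪Q (Q x), H₀ x⟫_ℂ).re ≤ ε * ‖x‖ ^ 2 := by
    intro x
    rw [hre, hre, hQ (Q x) x]
    linarith [hD x]
  have n1 : ∀ x, ‖x‖ ≤ g * ‖G x‖ := fun x => by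
    have := hGg' (G x)
    rwa [hG'G] at this
  have n2 : ∀ x, ‖x‖ ≤ g * ‖G' x‖ := fun x => by
    have := hGg (G' x)
    rwa [hGG'] at this
  have hδ : 0 ≤ Metric.diam (σ₀ : Set ℝ) := Metric.diam_nonneg
  have b0 : ∀ x ∈ V, H₀ x ∈ V := fun x hx => by
    rw [hH₀x]
    exact V.sub_mem (hHV x hx) (V.smul_mem _ hx)
  have b1 : ∀ x ∈ K, 0 ≤ (⟪x, H₀ x⟫_ℂ).re := fun x hx => by
    rw [hre']
    linarith [s1 x hx]
  have b2 : ∀ x ∈ K, x ∈ Vᗮ → ΔE * ‖x‖ ^ 2 ≤ (⟪x, H₀ x⟫_ℂ).re := fun x hx hxV => by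
    rw [hre']
    linarith [s2 x hx hxV]
  have b3 : ∀ x ∈ V, ‖H₀ x‖ ≤ Metric.diam (σ₀ : Set ℝ) * ‖x‖ := fun x hx => by
    rw [hH₀x]
    exact s3 x hx
  refine norm_trace_comp_starProjection_le A G G' hc hGG' hG'G hA hAc
    (norm_oblique_projection_le G G' hG hG' hGG' (fun v hv => ?_) fun v hv => ?_)
  · refine norm_sub_starProjection_le_of_gap hVK H₀ Q G R hΔE hδ hL hH₀s hQ hQK hGK b0 b1 b2 b3
      (fun x => ?_) hR hD₀ hQL hg hGg n1 hε h1 h2 h3 hv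
    simp only [hH₀x, map_sub, map_smul, hconj]
    abel
  · refine norm_sub_starProjection_le_of_gap hVK H₀ (-Q) G' R' hΔE hδ hL hH₀s
      (fun x y => ?_) (fun x hx => K.neg_mem (hQK x hx)) hGK' b0 b1 b2 b3
      (fun x => ?_) hR' (fun x => ?_) (fun x => ?_) hg hGg' n2 hε h1 h2 h3 hv
    · simp only [LinearMap.neg_apply, inner_neg_left, inner_neg_right, hQ x y]
    · simp only [LinearMap.neg_apply, hH₀x, map_sub, map_smul, map_neg, hconj']
      module
    · simpa using hD₀ x
    · simpa using hQL x

end Hilbert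

variable {Λ : Type} [Fintype Λ] [LinearOrder Λ]

/-! ### Charge gradings of Fock space operators. -/

section Charge

open scoped Matrix.Norms.L2Operator

/-- The total weight `∑_{x ∈ S} φ x` of the occupied modes. -/
def charge (φ : Mode Λ → ℝ) (S : Finset (Mode Λ)) : ℝ := ∑ x ∈ S, φ x

/-- The operator `∑_x φ x n_x`. -/
def chargeOp (φ : Mode Λ → ℝ) : Op Λ := Matrix.diagonal fun S => (charge φ S : ℂ)

/-- The operator `exp (-∑_x φ x n_x)`. -/
def expCharge (φ : Mode Λ → ℝ) : Op Λ :=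
  Matrix.diagonal fun S => (Real.exp (-charge φ S) : ℂ)

/-- `A` changes the charge with weights `φ` by `a`. -/
def Shifts (φ : Mode Λ → ℝ) (A : Op Λ) (a : ℝ) : Prop :=
  ∀ S T, A S T ≠ 0 → charge φ S = charge φ T + a

theorem charge_neg (φ : Mode Λ → ℝ) (S : Finset (Mode Λ)) : charge (-φ) S = -charge φ S := by
  simp [charge]

namespace Shifts

variable {φ : Mode Λ → ℝ} {A B : Op Λ} {a b : ℝ}

theorem mul (hA : Shifts φ A a) (hB : Shifts φ B b) : Shifts φ (A * B) (a + b) := by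
  intro S T h
  rw [Matrix.mul_apply] at h
  obtain ⟨U, -, hU⟩ := Finset.exists_ne_zero_of_sum_ne_zero h
  rw [hA S U (left_ne_zero_of_mul hU), hB U T (right_ne_zero_of_mul hU)]
  ring

theorem congr (hA : Shifts φ A a) (h : a = b) : Shifts φ A b := h ▸ hA

theorem zero : Shifts φ (0 : Op Λ) a := fun _ _ h => absurd rfl h

theorem add (hA : Shifts φ A a) (hB : Shifts φ B a) : Shifts φ (A + B) a := by
  intro S T h
  by_cases h0 : A S T = 0
  · refine hB S T fun h1 => h ?_
    rw [Matrix.add_apply, h0, h1, add_zero]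
  · exact hA S T h0

theorem smul (hA : Shifts φ A a) (z : ℂ) : Shifts φ (z • A) a := fun S T h =>
  hA S T fun h0 => h (by rw [Matrix.smul_apply, h0, smul_zero])

theorem neg (hA : Shifts φ A a) : Shifts φ (-A) a := fun S T h =>
  hA S T fun h0 => h (by rw [Matrix.neg_apply, h0, neg_zero])

theorem sum {ι : Type*} {s : Finset ι} {f : ι → Op Λ} (h : ∀ i ∈ s, Shifts φ (f i) a) :
    Shifts φ (∑ i ∈ s, f i) a := by
  intro S T h0
  rw [Matrix.sum_apply] at h0
  obtain ⟨i, hi, hi'⟩ := Finset.exists_ne_zero_of_sum_ne_zero h0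
  exact h i hi S T hi'

theorem conjTranspose (hA : Shifts φ A a) : Shifts φ A.conjTranspose (-a) := by
  intro S T h
  have := hA T S fun h0 => h (by rw [Matrix.conjTranspose_apply, h0, star_zero])
  linarith

theorem neg_weight (hA : Shifts φ A a) : Shifts (-φ) A (-a) := by
  intro S T h
  rw [charge_neg, charge_neg, hA S T h]
  ring

theorem chargeOp_mul (hA : Shifts φ A a) : chargeOp φ * A = A * chargeOp φ + (a : ℂ) • A := by
  ext S T
  rw [chargeOp, Matrix.add_apply, Matrix.diagonal_mul, Matrix.mul_diagonal, Matrix.smul_apply,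
    smul_eq_mul]
  by_cases h : A S T = 0
  · simp [h]
  · rw [hA S T h]
    push_cast
    ring

theorem expCharge_mul (hA : Shifts φ A a) :
    expCharge φ * A = (Real.exp (-a) : ℂ) • (A * expCharge φ) := by
  ext S T
  rw [expCharge, Matrix.diagonal_mul, Matrix.smul_apply, Matrix.mul_diagonal, smul_eq_mul]
  by_cases h : A S T = 0
  · simp [h]
  · rw [hA S T h, neg_add, Real.exp_add]
    push_cast
    ring

end Shifts

theorem shifts_diagonal (φ : Mode Λ → ℝ) (d : Finset (Mode Λ) → ℂ) :
    Shifts φ (Matrix.diagonal d) 0 := by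
  intro S T h
  by_cases hST : S = T
  · rw [hST, add_zero]
  · exact absurd (Matrix.diagonal_apply_ne d hST) h

theorem expCharge_mul_expCharge_neg (φ : Mode Λ → ℝ) : expCharge φ * expCharge (-φ) = 1 := by
  rw [expCharge, expCharge, Matrix.diagonal_mul_diagonal, ← Matrix.diagonal_one]
  congr 1
  ext S
  rw [charge_neg, neg_neg, ← Complex.ofReal_mul, ← Real.exp_add, neg_add_cancel, Real.exp_zero,
    Complex.ofReal_one]

theorem expCharge_neg_mul_expCharge (φ : Mode Λ → ℝ) : expCharge (-φ) * expCharge φ = 1 := by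
  simpa using expCharge_mul_expCharge_neg (-φ)

theorem norm_diagonal_le {d : Finset (Mode Λ) → ℂ} {c : ℝ} (hc : 0 ≤ c) (h : ∀ S, ‖d S‖ ≤ c) :
    ‖(Matrix.diagonal d : Op Λ)‖ ≤ c := by
  rw [Matrix.l2_opNorm_diagonal]
  exact (pi_norm_le_iff_of_nonneg hc).2 h

theorem abs_charge_le {φ : Mode Λ → ℝ} {L : ℝ} (h : ∑ x, |φ x| ≤ L) (S : Finset (Mode Λ)) :
    |charge φ S| ≤ L :=
  (Finset.abs_sum_le_sum_abs _ _).trans ((Finset.sum_le_sum_of_subset_of_nonneg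
    (Finset.subset_univ S) fun _ _ _ => abs_nonneg _).trans h)

theorem norm_chargeOp_le {φ : Mode Λ → ℝ} {L : ℝ} (h : ∑ x, |φ x| ≤ L) : ‖chargeOp φ‖ ≤ L :=
  norm_diagonal_le ((Finset.sum_nonneg fun _ _ => abs_nonneg _).trans h) fun S => by
    rw [Complex.norm_real]
    exact abs_charge_le h S

theorem norm_expCharge_le {φ : Mode Λ → ℝ} {L : ℝ} (h : ∑ x, |φ x| ≤ L) :
    ‖expCharge φ‖ ≤ Real.exp L :=
  norm_diagonal_le (Real.exp_pos _).le fun S => by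
    rw [Complex.norm_real, Real.norm_of_nonneg (Real.exp_pos _).le, Real.exp_le_exp]
    linarith [(abs_le.1 (abs_charge_le h S)).1]

/-! ### Fermion operators -/

theorem shifts_annihilate (φ : Mode Λ → ℝ) (i : Λ) (μ : Spin) :
    Shifts φ (annihilate i μ) (-φ (mode i μ)) := by
  intro S T h
  rw [annihilate, Matrix.of_apply, ne_eq, ite_eq_right_iff, Classical.not_imp] at h
  rw [h.1.2, charge, charge, ← Finset.sum_erase_add _ _ h.1.1]
  ring

theorem shifts_create (φ : Mode Λ → ℝ) (i : Λ) (μ : Spin) :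
    Shifts φ (create i μ) (φ (mode i μ)) :=
  (shifts_annihilate φ i μ).conjTranspose.congr (neg_neg _)

theorem shifts_create_mul_annihilate (φ : Mode Λ → ℝ) (i j : Λ) (μ ν : Spin) :
    Shifts φ (create i μ * annihilate j ν) (φ (mode i μ) - φ (mode j ν)) :=
  ((shifts_create φ i μ).mul (shifts_annihilate φ j ν)).congr (sub_eq_add_neg _ _).symm

theorem number_eq_diagonal (i : Λ) (μ : Spin) :
    number i μ = Matrix.diagonal fun S => if mode i μ ∈ S then 1 else 0 := by
  ext S T
  rw [number, create, Matrix.mul_apply]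
  simp only [Matrix.conjTranspose_apply, annihilate, Matrix.of_apply]
  rw [Finset.sum_eq_single (T.erase (mode i μ))]
  · by_cases hT : mode i μ ∈ T
    · by_cases hS : S = T
      · subst hS
        simp [hT, ← mul_pow]
      · rw [Matrix.diagonal_apply_ne _ hS, if_neg, star_zero, zero_mul]
        rintro ⟨h1, h2⟩
        exact hS (by rw [← Finset.insert_erase h1, ← h2, Finset.insert_erase hT])
    · by_cases hS : S = T
      · simp [hS, hT]
      · simp [hT, Matrix.diagonal_apply_ne _ hS]
  · intro U _ hU
    simp [hU]
  · simp

/-- By the C*-identity `‖c‖² = ‖c† c‖`, and `c† c` is diagonal with entries `0` and `1`. -/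
theorem norm_annihilate_le (i : Λ) (μ : Spin) : ‖annihilate i μ‖ ≤ 1 := by
  have h1 : ‖number i μ‖ ≤ 1 := by
    rw [number_eq_diagonal]
    refine norm_diagonal_le zero_le_one fun S => ?_
    split_ifs <;> simp
  rw [number, create, Matrix.l2_opNorm_conjTranspose_mul_self] at h1
  nlinarith [norm_nonneg (annihilate i μ)]

theorem norm_create_le (i : Λ) (μ : Spin) : ‖create i μ‖ ≤ 1 := by
  rw [create, Matrix.l2_opNorm_conjTranspose]
  exact norm_annihilate_le i μ

theorem norm_create_mul_annihilate_le (i j : Λ) (μ ν : Spin) :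
    ‖create i μ * annihilate j ν‖ ≤ 1 :=
  (norm_mul_le _ _).trans
    (mul_le_one₀ (norm_create_le i μ) (norm_nonneg _) (norm_annihilate_le j ν))

theorem sum_smul_number (φ : Mode Λ → ℝ) :
    ∑ i : Λ, ∑ μ : Spin, (φ (mode i μ) : ℂ) • number i μ = chargeOp φ := by
  ext S T
  simp only [number_eq_diagonal, chargeOp, Matrix.sum_apply, Matrix.smul_apply]
  by_cases h : S = T
  · subst h
    simp only [Matrix.diagonal_apply_eq, charge]
    have : ∑ x ∈ S, φ x = ∑ x, if x ∈ S then φ x else 0 := by simp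
    rw [this, ← toLex.sum_comp, Fintype.sum_prod_type, Complex.ofReal_sum]
    simp [apply_ite Complex.ofReal]
  · simp [Matrix.diagonal_apply_ne _ h]

theorem totalNumber_eq_chargeOp : totalNumber Λ = chargeOp fun _ => 1 := by
  rw [← sum_smul_number]
  simp [totalNumber]

theorem totalSpinZ_eq_chargeOp :
    totalSpinZ Λ = chargeOp fun x => if (ofLex x).2 = up then 1 else -1 := by
  rw [← sum_smul_number]
  refine Finset.sum_congr rfl fun i _ => ?_
  simp [spin, pauli, number]

theorem spinPlus_eq (i : Λ) : spinPlus i = (2 : ℂ) • (create i up * annihilate i down) := by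
  simp [spinPlus, spin, pauli, smul_add, smul_smul, two_smul]
  abel

theorem spinMinus_eq (i : Λ) : spinMinus i = (2 : ℂ) • (create i down * annihilate i up) := by
  simp [spinMinus, spin, pauli, smul_add, smul_smul, two_smul]

theorem isHermitian_spin (i : Λ) (a : Fin 3) : (spin i a).IsHermitian := by
  have h (μ ν : Spin) : (create i μ * annihilate i ν).conjTranspose =
      create i ν * annihilate i μ := by
    simp [create, Matrix.conjTranspose_mul]
  fin_cases a <;>
    simp [Matrix.IsHermitian, spin, pauli, Matrix.conjTranspose_add, Matrix.conjTranspose_smul, h,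
      add_comm]

/-! ### The Hamiltonian -/

open Classical in
/-- The hopping term with amplitudes `f i j μ`. -/
def Model.hopWith (M : Model Λ) (f : Λ → Λ → Spin → ℂ) : Op Λ :=
  -∑ i : Λ, ∑ j : Λ, if M.graph.Adj i j then
    ∑ μ : Spin, f i j μ • (create i μ * annihilate j μ) else 0

variable (M : Model Λ)

theorem Model.hopWith_sub (f g : Λ → Λ → Spin → ℂ) :
    M.hopWith (fun i j μ => f i j μ - g i j μ) = M.hopWith f - M.hopWith g := by
  simp only [Model.hopWith, sub_neg_eq_add, neg_add_eq_sub, sub_smul, Finset.sum_sub_distrib]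
  rw [← neg_sub, ← Finset.sum_sub_distrib]
  congr 1
  refine Finset.sum_congr rfl fun i _ => ?_
  rw [← Finset.sum_sub_distrib]
  refine Finset.sum_congr rfl fun j _ => ?_
  split_ifs <;> simp

/-- Each hop has a definite charge, so commuting with `Q` only rescales its amplitude. Keeping the
amplitudes general lets the lemma be iterated for double commutators. -/
theorem Model.chargeOp_mul_hopWith (φ : Mode Λ → ℝ) (f : Λ → Λ → Spin → ℂ) :
    chargeOp φ * M.hopWith f = M.hopWith f * chargeOp φ +
      M.hopWith fun i j μ => ((φ (mode i μ) - φ (mode j μ) : ℝ) : ℂ) * f i j μ := by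
  simp only [Model.hopWith, mul_neg, neg_mul, Finset.mul_sum, Finset.sum_mul, ← neg_add,
    ← Finset.sum_add_distrib]
  congr 1
  refine Finset.sum_congr rfl fun i _ => Finset.sum_congr rfl fun j _ => ?_
  split_ifs
  · simp only [Finset.mul_sum, Finset.sum_mul, ← Finset.sum_add_distrib]
    refine Finset.sum_congr rfl fun μ _ => ?_
    rw [Matrix.mul_smul, (shifts_create_mul_annihilate φ i j μ μ).chargeOp_mul, Matrix.smul_mul,
      smul_add, smul_smul, mul_comm]
  · simp

theorem Model.expCharge_mul_hopWith (φ : Mode Λ → ℝ) (f : Λ → Λ → Spin → ℂ) :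
    expCharge φ * M.hopWith f =
      (M.hopWith fun i j μ => (Real.exp (-(φ (mode i μ) - φ (mode j μ))) : ℂ) * f i j μ) *
        expCharge φ := by
  simp only [Model.hopWith, mul_neg, neg_mul, Finset.mul_sum, Finset.sum_mul]
  congr 1
  refine Finset.sum_congr rfl fun i _ => Finset.sum_congr rfl fun j _ => ?_
  split_ifs
  · simp only [Finset.mul_sum, Finset.sum_mul]
    refine Finset.sum_congr rfl fun μ _ => ?_
    rw [Matrix.mul_smul, (shifts_create_mul_annihilate φ i j μ μ).expCharge_mul, Matrix.smul_mul,
      smul_smul, mul_comm]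
  · simp

open Classical in
theorem Model.norm_hopWith_le (f : Λ → Λ → Spin → ℂ) :
    ‖M.hopWith f‖ ≤ ∑ i : Λ, ∑ j : Λ, if M.graph.Adj i j then ∑ μ : Spin, ‖f i j μ‖ else 0 := by
  rw [Model.hopWith, norm_neg]
  refine (norm_sum_le _ _).trans (Finset.sum_le_sum fun i _ => (norm_sum_le _ _).trans
    (Finset.sum_le_sum fun j _ => ?_))
  split_ifs
  · refine (norm_sum_le _ _).trans (Finset.sum_le_sum fun μ _ => ?_)
    rw [norm_smul]
    exact mul_le_of_le_one_right (norm_nonneg _) (norm_create_mul_annihilate_le i j μ μ)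
  · simp

/-- The part of the Hamiltonian that is local in the sites. -/
def Model.onsite : Op Λ :=
  Matrix.diagonal (fun S => (M.interaction S : ℂ)) +
    ∑ i : Λ, ∑ a : Fin 3, (M.field i a : ℂ) • spin i a

theorem Model.hamiltonian_eq :
    M.hamiltonian = M.hopWith (fun i j _ => M.hop i j) + M.onsite := by
  rw [Model.hamiltonian, Model.onsite, ← add_assoc]
  rfl

/-- Spin-independent weights commute with every spin operator at a site. If the weights of the two
spins differ, the spin-flipping components of the field must vanish there. -/
theorem Model.shifts_onsite {φ : Mode Λ → ℝ}
    (h : ∀ i, φ (mode i up) = φ (mode i down) ∨ (M.field i 0 = 0 ∧ M.field i 1 = 0)) :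
    Shifts φ M.onsite 0 := by
  refine (shifts_diagonal φ _).add (Shifts.sum fun i _ => ?_)
  have h2 : Shifts φ (spin i 2) 0 := by
    have : spin i 2 = number i up - number i down := by
      simp [spin, pauli, number, sub_eq_add_neg]
    rw [this, number_eq_diagonal, number_eq_diagonal, Matrix.diagonal_sub]
    exact shifts_diagonal φ _
  rcases h i with h | ⟨h0, h1⟩
  · refine Shifts.sum fun a _ => Shifts.smul (Shifts.sum fun μ _ => Shifts.sum fun ν _ =>
      ((shifts_create_mul_annihilate φ i i μ ν).congr ?_).smul _) _
    fin_cases μ <;> fin_cases ν <;> simp [h]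
  · rw [Fin.sum_univ_three, h0, h1, Complex.ofReal_zero, zero_smul, zero_smul, zero_add, zero_add]
    exact h2.smul _

theorem Model.isHermitian_hamiltonian : M.hamiltonian.IsHermitian := by
  refine ((?_ : M.hopping.IsHermitian).add ?_).add ?_
  · rw [Model.hopping]
    refine Matrix.IsHermitian.neg ?_
    rw [Matrix.IsHermitian, Matrix.conjTranspose_sum, Finset.sum_comm]
    simp only [Matrix.conjTranspose_sum]
    refine Finset.sum_congr rfl fun i _ => Finset.sum_congr rfl fun j _ => ?_
    by_cases h : M.graph.Adj i j
    · rw [if_pos h, if_pos h.symm, Matrix.conjTranspose_sum]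
      refine Finset.sum_congr rfl fun μ _ => ?_
      rw [Matrix.conjTranspose_smul, M.hop_symm i j h, Matrix.conjTranspose_mul, create,
        create, Matrix.conjTranspose_conjTranspose]
    · rw [if_neg h, if_neg fun h' => h h'.symm, Matrix.conjTranspose_zero]
  · exact Matrix.isHermitian_diagonal_of_self_adjoint _ (by ext S; simp)
  · rw [Matrix.IsHermitian, Matrix.conjTranspose_sum]
    refine Finset.sum_congr rfl fun i _ => ?_
    rw [Matrix.conjTranspose_sum]
    refine Finset.sum_congr rfl fun a _ => ?_
    rw [Matrix.conjTranspose_smul, (isHermitian_spin i a).eq, Complex.star_def, Complex.conj_ofReal]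

end Charge

/-! ### The twisted Hamiltonian and bounds on ground-state expectations. -/

section Expectation

open scoped Matrix.Norms.L2Operator InnerProductSpace

theorem toEuclideanLin_mul_apply (A B : Op Λ) (x : Fock Λ) :
    Matrix.toEuclideanLin (A * B) x = Matrix.toEuclideanLin A (Matrix.toEuclideanLin B x) := by
  rw [← Matrix.coe_toEuclideanCLM_eq_toEuclideanLin, map_mul]
  rfl

theorem norm_toEuclideanLin_apply_le (A : Op Λ) (x : Fock Λ) :
    ‖Matrix.toEuclideanLin A x‖ ≤ ‖A‖ * ‖x‖ :=
  (Matrix.toEuclideanCLM (𝕜 := ℂ) A).le_opNorm x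

theorem isSymmetric_toEuclideanLin_diagonal (d : Finset (Mode Λ) → ℝ) :
    (Matrix.toEuclideanLin (Matrix.diagonal fun S => (d S : ℂ) : Op Λ)).IsSymmetric :=
  Matrix.isSymmetric_toEuclideanLin_iff.2
    (Matrix.isHermitian_diagonal_of_self_adjoint _ (by ext S; simp))

theorem chargeOp_neg (φ : Mode Λ → ℝ) : chargeOp (-φ) = -chargeOp φ := by
  ext S T
  by_cases h : S = T
  · simp [h, chargeOp, charge_neg]
  · simp [chargeOp, Matrix.diagonal_apply_ne _ h]

variable (M : Model Λ)

/-- The second-order remainder of the Hamiltonian conjugated with `exp (-∑_x φ x n_x)`. -/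
def Model.remainder (φ : Mode Λ → ℝ) : Op Λ :=
  M.hopWith fun i j μ =>
    ((Real.exp (-(φ (mode i μ) - φ (mode j μ))) - 1 - -(φ (mode i μ) - φ (mode j μ)) : ℝ) : ℂ) *
      M.hop i j

theorem Model.commutator_hamiltonian {φ : Mode Λ → ℝ} (hφ : Shifts φ M.onsite 0) :
    chargeOp φ * M.hamiltonian - M.hamiltonian * chargeOp φ =
      M.hopWith fun i j μ => ((φ (mode i μ) - φ (mode j μ) : ℝ) : ℂ) * M.hop i j := by
  rw [M.hamiltonian_eq, mul_add, add_mul, M.chargeOp_mul_hopWith, hφ.chargeOp_mul]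
  simp

/-- Conjugation multiplies the amplitude of a hop with increment `d` by `exp (-d)`. The Taylor terms
`1` and `-d` reproduce `H` and `[H, Q]`, leaving the remainder. -/
theorem Model.expCharge_mul_hamiltonian {φ : Mode Λ → ℝ} (hφ : Shifts φ M.onsite 0) :
    expCharge φ * M.hamiltonian =
      (M.hamiltonian + (M.hamiltonian * chargeOp φ - chargeOp φ * M.hamiltonian) +
        M.remainder φ) * expCharge φ := by
  have h1 : M.remainder φ = M.hopWith (fun i j μ =>
      (Real.exp (-(φ (mode i μ) - φ (mode j μ))) : ℂ) * M.hop i j) -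
      (M.hopWith (fun i j _ => M.hop i j) -
      M.hopWith (fun i j μ => ((φ (mode i μ) - φ (mode j μ) : ℝ) : ℂ) * M.hop i j)) := by
    rw [← M.hopWith_sub, ← M.hopWith_sub, Model.remainder]
    refine congrArg M.hopWith (funext₃ fun i j μ => ?_)
    push_cast
    ring
  rw [← neg_sub (chargeOp φ * _), M.commutator_hamiltonian hφ, h1, M.hamiltonian_eq, mul_add,
    M.expCharge_mul_hopWith, hφ.expCharge_mul]
  simp only [neg_zero, Real.exp_zero, Complex.ofReal_one, one_smul]
  rw [← add_mul]
  congr 1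
  abel

-- Increments of size at most one permit `|exp x - 1 - x| ≤ x²` on every bond.
open Classical in
theorem Model.norm_remainder_le {φ : Mode Λ → ℝ}
    (h1 : ∀ i j, M.graph.Adj i j → ∀ μ, |φ (mode i μ) - φ (mode j μ)| ≤ 1) :
    ‖M.remainder φ‖ ≤ ∑ i : Λ, ∑ j : Λ, if M.graph.Adj i j then
      ∑ μ : Spin, ‖M.hop i j‖ * (φ (mode i μ) - φ (mode j μ)) ^ 2 else 0 := by
  refine (M.norm_hopWith_le _).trans (Finset.sum_le_sum fun i _ => Finset.sum_le_sum fun j _ => ?_)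
  split_ifs with h
  · refine Finset.sum_le_sum fun μ _ => ?_
    rw [norm_mul, mul_comm, Complex.norm_real, Real.norm_eq_abs]
    refine mul_le_mul_of_nonneg_left ?_ (norm_nonneg _)
    rw [← neg_sq]
    exact Real.abs_exp_sub_one_sub_id_le (by rw [abs_neg]; exact h1 i j h μ)
  · rfl

-- The expression is `-[Q, [Q, H]]`, and each commutator contributes one factor of the increment to
-- the amplitude.
open Classical in
theorem Model.norm_double_commutator_le {φ : Mode Λ → ℝ} (hφ : Shifts φ M.onsite 0) :
    ‖(2 : ℂ) • (chargeOp φ * (M.hamiltonian * chargeOp φ)) -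
        chargeOp φ * (chargeOp φ * M.hamiltonian) - M.hamiltonian * (chargeOp φ * chargeOp φ)‖ ≤
      ∑ i : Λ, ∑ j : Λ, if M.graph.Adj i j then
        ∑ μ : Spin, ‖M.hop i j‖ * (φ (mode i μ) - φ (mode j μ)) ^ 2 else 0 := by
  have h : (2 : ℂ) • (chargeOp φ * (M.hamiltonian * chargeOp φ)) -
      chargeOp φ * (chargeOp φ * M.hamiltonian) - M.hamiltonian * (chargeOp φ * chargeOp φ) =
      -(chargeOp φ * (chargeOp φ * M.hamiltonian - M.hamiltonian * chargeOp φ) -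
        (chargeOp φ * M.hamiltonian - M.hamiltonian * chargeOp φ) * chargeOp φ) := by
    rw [two_smul]
    noncomm_ring
  rw [h, M.commutator_hamiltonian hφ, norm_neg, M.chargeOp_mul_hopWith, add_sub_cancel_left]
  refine (M.norm_hopWith_le _).trans (Finset.sum_le_sum fun i _ => Finset.sum_le_sum fun j _ => ?_)
  split_ifs with h
  · refine Finset.sum_le_sum fun μ _ => le_of_eq ?_
    rw [norm_mul, norm_mul, ← mul_assoc, ← norm_mul, ← Complex.ofReal_mul, ← sq, mul_comm,
      Complex.norm_real, Real.norm_of_nonneg (sq_nonneg _)]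
  · rfl

open Classical in
/-- An operator of charge `a` with respect to the weights `φ` has a ground-state expectation of
order `exp (-a)` if the weights vary so slowly that their Dirichlet form is small compared
to the gap. -/
theorem Model.norm_groundExpectation_le_exp {K : Submodule ℂ (Fock Λ)} {σ₀ : Finset ℝ}
    {ΔE L a c : ℝ} (hΔE : 0 < ΔE) (hσ : IsGroundSector M.hamiltonian K σ₀ ΔE)
    (hHK : ∀ x ∈ K, Matrix.toEuclideanLin M.hamiltonian x ∈ K)
    (hdK : ∀ d, ∀ x ∈ K, Matrix.toEuclideanLin (Matrix.diagonal d : Op Λ) x ∈ K)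
    {φ : Mode Λ → ℝ} (hφ : Shifts φ M.onsite 0)
    (h1 : ∀ i j, M.graph.Adj i j → ∀ μ, |φ (mode i μ) - φ (mode j μ)| ≤ 1)
    (hε : (∑ i : Λ, ∑ j : Λ, if M.graph.Adj i j then
      ∑ μ : Spin, ‖M.hop i j‖ * (φ (mode i μ) - φ (mode j μ)) ^ 2 else 0) ≤ ΔE / 64)
    (hL : ∑ x, |φ x| ≤ L) (hδ : Real.exp (2 * L) * Metric.diam (σ₀ : Set ℝ) ≤ ΔE / 128)
    {A : Op Λ} (hA : Shifts φ A a) (hc : ‖A‖ ≤ c) :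
    ‖groundExpectation M.hamiltonian K σ₀ A‖ ≤ 3 * c * Real.exp (-a) := by
  have hc0 : 0 ≤ c := (norm_nonneg _).trans hc
  have hL0 : 0 ≤ L := (Finset.sum_nonneg fun _ _ => abs_nonneg _).trans hL
  have hδ0 : 0 ≤ Metric.diam (σ₀ : Set ℝ) := Metric.diam_nonneg
  have hφn : Shifts (-φ) M.onsite 0 := by simpa using hφ.neg_weight
  have h1n : ∀ i j, M.graph.Adj i j → ∀ μ, |(-φ) (mode i μ) - (-φ) (mode j μ)| ≤ 1 := by
    intro i j h μ
    rw [Pi.neg_apply, Pi.neg_apply, neg_sub_neg, abs_sub_comm]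
    exact h1 i j h μ
  have hLn : ∑ x, |(-φ) x| ≤ L := by simpa using hL
  have hRn : ‖M.remainder (-φ)‖ ≤ ΔE / 64 := by
    refine ((M.norm_remainder_le h1n).trans (le_of_eq ?_)).trans hε
    refine Finset.sum_congr rfl fun i _ => Finset.sum_congr rfl fun j _ => ?_
    congr 1
    refine Finset.sum_congr rfl fun μ _ => ?_
    rw [Pi.neg_apply, Pi.neg_apply]
    ring
  have hsym := Matrix.isSymmetric_toEuclideanLin_iff.2 M.isHermitian_hamiltonian
  have hQ : (Matrix.toEuclideanLin (chargeOp φ)).IsSymmetric := isSymmetric_toEuclideanLin_diagonal _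
  have hb := fun (A : Op Λ) (c : ℝ) (h : ‖A‖ ≤ c) (x : Fock Λ) =>
    (norm_toEuclideanLin_apply_le A x).trans (mul_le_mul_of_nonneg_right h (norm_nonneg x))
  -- With `g = exp L`, the factors `L`, `L²` and `g²` are all at most `exp (2 L)`, so `hδ` covers
  -- the three conditions on the width of the sector.
  have hLe : L ≤ Real.exp (2 * L) := by linarith [Real.add_one_le_exp (2 * L)]
  have hLe' : L ≤ Real.exp L := by linarith [Real.add_one_le_exp L]
  have hee : Real.exp L ^ 2 = Real.exp (2 * L) := by rw [← Real.exp_nat_mul]; norm_num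
  have main := norm_trace_ground_le_exp (K := K) (Matrix.toEuclideanLin M.hamiltonian)
    (Matrix.toEuclideanLin (chargeOp φ)) (Matrix.toEuclideanLin (expCharge φ))
    (Matrix.toEuclideanLin (expCharge (-φ))) (Matrix.toEuclideanLin (M.remainder φ))
    (Matrix.toEuclideanLin (M.remainder (-φ))) (Matrix.toEuclideanLin A) (a := a) (c := c)
    (ε := ΔE / 64) (L := L) (g := Real.exp L)
    hsym hQ (isSymmetric_toEuclideanLin_diagonal _) (isSymmetric_toEuclideanLin_diagonal _)
    hHK (hdK _) (hdK _) (hdK _) hΔE hσ.nonempty hσ.gap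
    (fun x => by rw [← toEuclideanLin_mul_apply, expCharge_mul_expCharge_neg]; simp)
    (fun x => by rw [← toEuclideanLin_mul_apply, expCharge_neg_mul_expCharge]; simp)
    (fun x => by
      rw [← toEuclideanLin_mul_apply, M.expCharge_mul_hamiltonian hφ]
      simp only [toEuclideanLin_mul_apply, map_add, map_sub, LinearMap.add_apply,
        LinearMap.sub_apply])
    (fun x => by
      rw [← toEuclideanLin_mul_apply, M.expCharge_mul_hamiltonian hφn, chargeOp_neg]
      simp only [toEuclideanLin_mul_apply, map_add, map_sub, map_neg, LinearMap.add_apply,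
        LinearMap.sub_apply, LinearMap.neg_apply, mul_neg, neg_mul]
      abel)
    (hb _ _ ((M.norm_remainder_le h1).trans hε)) (hb _ _ hRn)
    (fun x => ?_) hL0 (hb _ _ (norm_chargeOp_le hL)) (Real.exp_pos _).le
    (hb _ _ (norm_expCharge_le hL)) (hb _ _ (norm_expCharge_le hLn)) le_rfl
    ((mul_le_mul_of_nonneg_right hLe hδ0).trans hδ)
    ((mul_le_mul_of_nonneg_right (by rw [← hee]; gcongr) hδ0).trans hδ) (by rwa [hee])
    (fun x => ?_) hc0 (hb _ _ hc)
  · rw [groundExpectation, norm_mul, norm_inv, Complex.norm_natCast]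
    refine (mul_le_mul_of_nonneg_left main (by positivity)).trans ?_
    change (Module.finrank ℂ (groundSpace M.hamiltonian K σ₀) : ℝ)⁻¹ *
      (_ * (Module.finrank ℂ (groundSpace M.hamiltonian K σ₀) : ℝ)) ≤ _
    rw [mul_left_comm]
    exact mul_le_of_le_one_right (by positivity) (inv_mul_le_one)
  -- By symmetry of `Q` and `H`, the left side of `hD` is the real quadratic form of the double
  -- commutator bounded above.
  · have e : (2 * (⟪Matrix.toEuclideanLin (chargeOp φ) x, Matrix.toEuclideanLin M.hamiltonian
          (Matrix.toEuclideanLin (chargeOp φ) x)⟫_ℂ).re -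
        2 * (⟪Matrix.toEuclideanLin (chargeOp φ) (Matrix.toEuclideanLin (chargeOp φ) x),
          Matrix.toEuclideanLin M.hamiltonian x⟫_ℂ).re) =
        (⟪x, Matrix.toEuclideanLin ((2 : ℂ) • (chargeOp φ * (M.hamiltonian * chargeOp φ)) -
        chargeOp φ * (chargeOp φ * M.hamiltonian) -
        M.hamiltonian * (chargeOp φ * chargeOp φ)) x⟫_ℂ).re := by
      simp only [map_sub, map_smul, LinearMap.sub_apply, LinearMap.smul_apply,
        toEuclideanLin_mul_apply, inner_sub_right, inner_smul_right, Complex.sub_re]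
      rw [← hQ x, ← hQ x, ← hQ (Matrix.toEuclideanLin (chargeOp φ) x), ← hsym x,
        ← inner_conj_symm (Matrix.toEuclideanLin M.hamiltonian x), Complex.conj_re]
      have : ∀ z : ℂ, ((2 : ℂ) * z).re = 2 * z.re := fun z => by simp
      rw [this]
      ring
    rw [e]
    calc _ ≤ ‖x‖ * (ΔE / 64 * ‖x‖) := (Complex.re_le_norm _).trans ((norm_inner_le_norm _ _).trans
          (mul_le_mul_of_nonneg_left
            (hb _ _ ((M.norm_double_commutator_le hφ).trans hε) x) (norm_nonneg _)))
      _ = _ := by ring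
  · rw [← toEuclideanLin_mul_apply, ← toEuclideanLin_mul_apply, hA.expCharge_mul,
      Matrix.smul_mul, mul_assoc, expCharge_mul_expCharge_neg, mul_one, map_smul,
      LinearMap.smul_apply]

end Expectation

/-! ### Ball volumes and the Dirichlet energy of the tent weight. -/

section Lattice

-- The open ball is a union of `r` spheres. As `D ≥ 1`, each has at most `(1 + C₀) r ^ (D - 1)`
-- sites, the `1` accounting for the centre.
open Classical in
theorem HasDimension.card_ball_le {G : SimpleGraph Λ} (hG : G.Connected) {D C₀ : ℝ} (hD : 1 ≤ D)
    (hC₀ : 0 < C₀) (h : HasDimension G D C₀) (m : Λ) {r : ℕ} (hr : 1 ≤ r) :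
    ((Finset.univ.filter fun l => G.dist l m < r).card : ℝ) ≤ (1 + C₀) * (r : ℝ) ^ D := by
  have hr' : (1 : ℝ) ≤ r := by exact_mod_cast hr
  have h1 : (Finset.univ.filter fun l => G.dist l m < r) ⊆
      (Finset.range r).biUnion fun k => Finset.univ.filter fun l => G.dist l m = k := by
    intro l hl
    simpa using hl
  have h2 : ∀ k ∈ Finset.range r, ((Finset.univ.filter fun l => G.dist l m = k).card : ℝ) ≤
      (1 + C₀) * (r : ℝ) ^ (D - 1) := by
    intro k hk
    have hone : (1 : ℝ) ≤ (r : ℝ) ^ (D - 1) := Real.one_le_rpow hr' (by linarith)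
    rcases Nat.eq_zero_or_pos k with rfl | hk0
    · have : (Finset.univ.filter fun l => G.dist l m = 0) = {m} := by
        ext l
        simp [hG.dist_eq_zero_iff]
      rw [this, Finset.card_singleton]
      push_cast
      nlinarith
    · have h3 := h m k hk0
      rw [Set.ncard_eq_toFinset_card', Set.toFinset_ofPred] at h3
      have h4 : (k : ℝ) ^ (D - 1) ≤ (r : ℝ) ^ (D - 1) :=
        Real.rpow_le_rpow (Nat.cast_nonneg k) (by exact_mod_cast (Finset.mem_range.1 hk).le)
          (by linarith)
      refine h3.trans ?_
      nlinarith
  calc _ ≤ ((∑ k ∈ Finset.range r, (Finset.univ.filter fun l => G.dist l m = k).card : ℕ) : ℝ) := by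
        exact_mod_cast (Finset.card_le_card h1).trans Finset.card_biUnion_le
    _ ≤ ∑ k ∈ Finset.range r, (1 + C₀) * (r : ℝ) ^ (D - 1) := by
        push_cast
        exact Finset.sum_le_sum h2
    _ = (1 + C₀) * ((r : ℝ) ^ (D - 1) * r) := by simp; ring
    _ = _ := by rw [← Real.rpow_add_one (by positivity), sub_add_cancel]

open Classical in
theorem HasDimension.card_neighbors_le {G : SimpleGraph Λ} {D C₀ : ℝ} (h : HasDimension G D C₀)
    (i : Λ) : ((Finset.univ.filter fun j => G.Adj i j).card : ℝ) ≤ C₀ := by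
  have h1 := h i 1 le_rfl
  rw [Set.ncard_eq_toFinset_card', Set.toFinset_ofPred, Nat.cast_one, Real.one_rpow, mul_one] at h1
  refine le_trans ?_ h1
  refine Nat.cast_le.2 (Finset.card_le_card fun j hj => ?_)
  simp only [Finset.mem_filter, Finset.mem_univ, true_and] at hj ⊢
  exact SimpleGraph.dist_eq_one_iff_adj.2 hj.symm

/-- The site weight that decreases linearly in the distance from `m`, with slope
`β dist(m,n)^(-D/2)`, and vanishes at `n`. -/
def tent (G : SimpleGraph Λ) (D β : ℝ) (m n l : Λ) : ℝ :=
  β * (G.dist m n : ℝ) ^ (-(D / 2)) * ((G.dist m n - G.dist l m : ℕ) : ℝ)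

variable {G : SimpleGraph Λ} {D β : ℝ}

theorem tent_self_sub (hD : D < 2) (m n : Λ) :
    tent G D β m n m - tent G D β m n n = β * (G.dist m n : ℝ) ^ (1 - D / 2) := by
  rw [tent, tent, SimpleGraph.dist_self, G.dist_comm (u := n), Nat.sub_self, Nat.sub_zero,
    Nat.cast_zero, mul_zero, sub_zero, mul_assoc]
  congr 1
  rcases Nat.eq_zero_or_pos (G.dist m n) with h | h
  · rw [h, Nat.cast_zero, mul_zero, Real.zero_rpow (by linarith)]
  · rw [← Real.rpow_add_one (by positivity)]
    ring_nf

theorem tent_nonneg (hβ : 0 ≤ β) (m n l : Λ) : 0 ≤ tent G D β m n l := by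
  unfold tent
  positivity

theorem abs_tent_sub_le (hG : G.Connected) (hβ : 0 ≤ β) (m n : Λ) {i j : Λ} (hij : G.Adj i j) :
    |tent G D β m n i - tent G D β m n j| ≤ β * (G.dist m n : ℝ) ^ (-(D / 2)) := by
  rw [tent, tent, ← mul_sub, abs_mul, abs_of_nonneg (by positivity)]
  -- Truncated subtraction is 1-Lipschitz, and distances to `m` from adjacent sites differ by at
  -- most one.
  refine mul_le_of_le_one_right (by positivity) ?_
  have h1 := hG.dist_triangle (u := i) (v := j) (w := m)
  have h2 := hG.dist_triangle (u := j) (v := i) (w := m)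
  rw [SimpleGraph.dist_eq_one_iff_adj.2 hij] at h1
  rw [SimpleGraph.dist_eq_one_iff_adj.2 hij.symm] at h2
  rw [abs_le]
  constructor
  · have : G.dist m n - G.dist j m ≤ G.dist m n - G.dist i m + 1 := by omega
    have : ((G.dist m n - G.dist j m : ℕ) : ℝ) ≤ (G.dist m n - G.dist i m : ℕ) + 1 := by
      exact_mod_cast this
    linarith
  · have : G.dist m n - G.dist i m ≤ G.dist m n - G.dist j m + 1 := by omega
    have : ((G.dist m n - G.dist i m : ℕ) : ℝ) ≤ (G.dist m n - G.dist j m : ℕ) + 1 := by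
      exact_mod_cast this
    linarith

theorem tent_eq_zero {m n l : Λ} (h : ¬ G.dist l m < G.dist m n) : tent G D β m n l = 0 := by
  rw [tent, Nat.sub_eq_zero_of_le (not_lt.1 h), Nat.cast_zero, mul_zero]

theorem natCast_rpow_neg_le_one (r : ℕ) (hD : 0 < D) : (r : ℝ) ^ (-(D / 2)) ≤ 1 := by
  rcases Nat.eq_zero_or_pos r with h | h
  · rw [h, Nat.cast_zero, Real.zero_rpow (by linarith)]
    exact zero_le_one
  · exact Real.rpow_le_one_of_one_le_of_nonpos (by exact_mod_cast h) (by linarith)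

-- The choice of slope pays off here: the ball volume `r ^ D` cancels the squared slope `β² r ^
-- (-D)`, and the bound is independent of `r`.
open Classical in
theorem sum_tent_sub_sq_le (hG : G.Connected) {C₀ : ℝ} (hD : 1 ≤ D) (hC₀ : 0 < C₀)
    (h : HasDimension G D C₀) (hβ : 0 ≤ β) (m n : Λ) :
    (∑ i, ∑ j, if G.Adj i j then (tent G D β m n i - tent G D β m n j) ^ 2 else 0) ≤
      2 * C₀ * (1 + C₀) * β ^ 2 := by
  set r := G.dist m n with hr
  set s := (β * (r : ℝ) ^ (-(D / 2))) ^ 2 with hs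
  have hs0 : 0 ≤ s := sq_nonneg _
  -- A bond contributes only if one of its ends lies in the ball; its energy is charged to such an
  -- end, and an end has at most `C₀` bonds.
  let u : Λ → ℝ := fun i => if G.dist i m < r then s else 0
  have hu0 : ∀ i, 0 ≤ u i := fun i => by
    simp only [u]
    split_ifs <;> simp [hs0]
  have h1 : ∀ i j, G.Adj i j → (tent G D β m n i - tent G D β m n j) ^ 2 ≤ u i + u j := by
    intro i j hij
    have h2 : (tent G D β m n i - tent G D β m n j) ^ 2 ≤ s := by
      rw [← sq_abs]
      exact pow_le_pow_left₀ (abs_nonneg _) (abs_tent_sub_le hG hβ m n hij) 2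
    by_cases hi : G.dist i m < r
    · have : u i = s := if_pos hi
      linarith [hu0 j]
    · by_cases hj : G.dist j m < r
      · have : u j = s := if_pos hj
        linarith [hu0 i]
      · rw [tent_eq_zero hi, tent_eq_zero hj]
        simpa using add_nonneg (hu0 i) (hu0 j)
  have h3 : (∑ i, ∑ j, if G.Adj i j then u i else 0) ≤ C₀ * (1 + C₀) * β ^ 2 := by
    have h4 : ∀ i, (∑ j, if G.Adj i j then u i else 0) ≤ C₀ * u i := fun i => by
      rw [← Finset.sum_filter, Finset.sum_const, nsmul_eq_mul]
      exact mul_le_mul_of_nonneg_right (h.card_neighbors_le i) (hu0 i)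
    refine (Finset.sum_le_sum fun i _ => h4 i).trans ?_
    rw [← Finset.mul_sum, ← Finset.sum_filter, Finset.sum_const, nsmul_eq_mul, mul_assoc]
    refine mul_le_mul_of_nonneg_left ?_ hC₀.le
    rcases Nat.eq_zero_or_pos r with h0 | h0
    · simp only [h0, not_lt_zero, Finset.filter_false, Finset.card_empty, Nat.cast_zero, zero_mul]
      positivity
    · refine (mul_le_mul_of_nonneg_right (h.card_ball_le hG hD hC₀ m h0) hs0).trans (le_of_eq ?_)
      have hr0 : (0 : ℝ) < r := by exact_mod_cast h0
      have : (r : ℝ) ^ D * ((r : ℝ) ^ (-(D / 2))) ^ 2 = 1 := by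
        rw [← Real.rpow_natCast, ← Real.rpow_mul hr0.le, ← Real.rpow_add hr0]
        simp
      rw [hs, mul_pow]
      linear_combination (1 + C₀) * β ^ 2 * this
  calc _ ≤ ∑ i, ∑ j, ((if G.Adj i j then u i else 0) + if G.Adj i j then u j else 0) := by
        refine Finset.sum_le_sum fun i _ => Finset.sum_le_sum fun j _ => ?_
        split_ifs with hij
        · exact h1 i j hij
        · simp
    _ = 2 * ∑ i, ∑ j, if G.Adj i j then u i else 0 := by
        simp only [Finset.sum_add_distrib]
        rw [Finset.sum_comm (f := fun i j => if G.Adj i j then u j else 0), two_mul]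
        simp only [G.adj_comm]
    _ ≤ _ := by linarith

-- Only independence of the volume matters, so the exponent is crude: at most `(1 + C₀) r ^ D` sites
-- of height at most `r`, with `D < 2`.
open Classical in
theorem sum_tent_le (hG : G.Connected) {C₀ : ℝ} (hD : 1 ≤ D) (hD₂ : D < 2) (hC₀ : 0 < C₀)
    (h : HasDimension G D C₀) (hβ₁ : β ≤ 1) {m n : Λ} {R : ℕ}
    (hR : G.dist m n ≤ R) : ∑ l, tent G D β m n l ≤ (1 + C₀) * (R : ℝ) ^ 3 := by
  set r := G.dist m n with hr
  have h1 : ∀ l, tent G D β m n l ≤ if G.dist l m < r then (r : ℝ) else 0 := fun l => by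
    split_ifs with hl
    · rw [tent]
      have h2 : β * (r : ℝ) ^ (-(D / 2)) ≤ 1 :=
        mul_le_one₀ hβ₁ (by positivity) (natCast_rpow_neg_le_one r (by linarith))
      have h3 : ((r - G.dist l m : ℕ) : ℝ) ≤ r := by exact_mod_cast Nat.sub_le _ _
      exact (mul_le_of_le_one_left (Nat.cast_nonneg _) h2).trans h3
    · exact (tent_eq_zero hl).le
  refine (Finset.sum_le_sum fun l _ => h1 l).trans ?_
  rw [← Finset.sum_filter, Finset.sum_const, nsmul_eq_mul]
  rcases Nat.eq_zero_or_pos r with h0 | h0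
  · rw [h0, Nat.cast_zero, mul_zero]
    positivity
  · have hr1 : (1 : ℝ) ≤ r := by exact_mod_cast h0
    have hrR : (r : ℝ) ≤ R := by exact_mod_cast hR
    calc _ ≤ (1 + C₀) * (r : ℝ) ^ D * r := by
          gcongr
          exact h.card_ball_le hG hD hC₀ m h0
      _ ≤ (1 + C₀) * (r : ℝ) ^ (2 : ℝ) * r := by
          gcongr
      _ = (1 + C₀) * (r : ℝ) ^ 3 := by
          rw [Real.rpow_two]
          ring
      _ ≤ _ := by gcongr

/-- The weight of the modes given by a weight `κ` of the spins and a weight `f` of the sites. -/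
def modeWeight (κ : Spin → ℝ) (f : Λ → ℝ) (x : Mode Λ) : ℝ := κ (ofLex x).2 * f (ofLex x).1

@[simp]
theorem modeWeight_mode (κ : Spin → ℝ) (f : Λ → ℝ) (i : Λ) (μ : Spin) :
    modeWeight κ f (mode i μ) = κ μ * f i := rfl

end Lattice

/-! ### Decay of the correlation functions. -/

section Decay

open scoped Matrix.Norms.L2Operator

/-- The decay rate obtained from a gap `ΔE`. -/
def decayRate (C₀ tmax ΔE : ℝ) : ℝ :=
  min 1 (ΔE / (256 * (|tmax| + 1) * C₀ * (1 + C₀)))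

theorem decayRate_pos {C₀ tmax ΔE : ℝ} (hC₀ : 0 < C₀) (hΔE : 0 < ΔE) :
    0 < decayRate C₀ tmax ΔE := by
  unfold decayRate
  positivity

theorem Model.norm_groundExpectation_le_exp_dist (M : Model Λ)
    {D C₀ tmax Vmax Bmax ΔE : ℝ} {r₀ : ℕ} (hD₁ : 1 ≤ D) (hD₂ : D < 2) (hC₀ : 0 < C₀)
    (hΔE : 0 < ΔE) (hM : M.IsAdmissible D C₀ tmax Vmax Bmax r₀)
    {K : Submodule ℂ (Fock Λ)} {σ₀ : Finset ℝ} (hσ : IsGroundSector M.hamiltonian K σ₀ ΔE)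
    (hHK : ∀ x ∈ K, Matrix.toEuclideanLin M.hamiltonian x ∈ K)
    (hdK : ∀ d, ∀ x ∈ K, Matrix.toEuclideanLin (Matrix.diagonal d : Op Λ) x ∈ K)
    {κ : Spin → ℝ} (hκ : ∀ μ, |κ μ| ≤ 1)
    (hκM : ∀ f, Shifts (modeWeight κ f) M.onsite 0) {R : ℕ} {m n : Λ}
    (hR : M.graph.dist m n ≤ R)
    (hδ : Real.exp (2 * (2 * ((1 + C₀) * (R : ℝ) ^ 3))) * Metric.diam (σ₀ : Set ℝ) ≤ ΔE / 128)
    {A : Op Λ} {p : ℝ} (hA : ∀ f, Shifts (modeWeight κ f) A (p * (f m - f n))) (hA4 : ‖A‖ ≤ 4) :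
    ‖groundExpectation M.hamiltonian K σ₀ A‖ ≤
      12 * Real.exp (-(p * decayRate C₀ tmax ΔE) * (M.graph.dist m n : ℝ) ^ (1 - D / 2)) := by
  classical
  set β := decayRate C₀ tmax ΔE with hβdef
  have hβ : 0 < β := decayRate_pos hC₀ hΔE
  have hβ₁ : β ≤ 1 := min_le_left _ _
  -- The two spins and `sum_tent_sub_sq_le` give energy at most `4 (|tmax| + 1) C₀ (1 + C₀) β`,
  -- using `β² ≤ β`; the required `ΔE / 64` turns `4` into `256`.
  have hβ₂ : 256 * (|tmax| + 1) * C₀ * (1 + C₀) * β ≤ ΔE := by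
    rw [← le_div_iff₀' (by positivity)]
    exact min_le_right _ _
  set f := tent M.graph D β m n with hf
  have hκsq : ∀ μ, κ μ ^ 2 ≤ 1 := fun μ => by
    rw [← sq_abs]
    exact pow_le_one₀ (abs_nonneg _) (hκ μ)
  have h1 : ∀ i j, M.graph.Adj i j → ∀ μ,
      |modeWeight κ f (mode i μ) - modeWeight κ f (mode j μ)| ≤ 1 := fun i j hij μ => by
    rw [modeWeight_mode, modeWeight_mode, ← mul_sub, abs_mul]
    exact mul_le_one₀ (hκ μ) (abs_nonneg _) ((abs_tent_sub_le hM.connected hβ.le m n hij).trans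
      (mul_le_one₀ hβ₁ (by positivity) (natCast_rpow_neg_le_one _ (by linarith))))
  have hε : (∑ i : Λ, ∑ j : Λ, if M.graph.Adj i j then ∑ μ : Spin, ‖M.hop i j‖ *
      (modeWeight κ f (mode i μ) - modeWeight κ f (mode j μ)) ^ 2 else 0) ≤ ΔE / 64 := by
    calc _ ≤ ∑ i : Λ, ∑ j : Λ, 2 * |tmax| * if M.graph.Adj i j then (f i - f j) ^ 2 else 0 := by
          refine Finset.sum_le_sum fun i _ => Finset.sum_le_sum fun j _ => ?_
          split_ifs with hij
          · have : ∀ μ ∈ (Finset.univ : Finset Spin), ‖M.hop i j‖ *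
                (modeWeight κ f (mode i μ) - modeWeight κ f (mode j μ)) ^ 2 ≤
                |tmax| * (f i - f j) ^ 2 := fun μ _ => by
              rw [modeWeight_mode, modeWeight_mode, ← mul_sub, mul_pow]
              gcongr
              · exact (hM.hop_le i j hij).trans (le_abs_self _)
              · exact mul_le_of_le_one_left (sq_nonneg _) (hκsq μ)
            refine (Finset.sum_le_card_nsmul _ _ _ this).trans (le_of_eq ?_)
            simp
            ring
          · simp
      _ ≤ 2 * |tmax| * (2 * C₀ * (1 + C₀) * β ^ 2) := by
          simp only [← Finset.mul_sum]
          gcongr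
          exact sum_tent_sub_sq_le hM.connected hD₁ hC₀ hM.dimension hβ.le m n
      _ ≤ 2 * (|tmax| + 1) * (2 * C₀ * (1 + C₀) * β) := by
          gcongr
          · linarith
          · nlinarith
      _ ≤ _ := by linarith
  have hL : ∑ x, |modeWeight κ f x| ≤ 2 * ((1 + C₀) * (R : ℝ) ^ 3) := by
    rw [← toLex.sum_comp, Fintype.sum_prod_type]
    calc _ ≤ ∑ i : Λ, 2 * f i := by
          refine Finset.sum_le_sum fun i _ => ?_
          have : ∀ μ ∈ (Finset.univ : Finset Spin), |modeWeight κ f (toLex (i, μ))| ≤ f i :=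
            fun μ _ => by
              rw [modeWeight, abs_mul]
              change |κ μ| * |f i| ≤ f i
              have h0 : 0 ≤ f i := tent_nonneg hβ.le m n i
              rw [abs_of_nonneg h0]
              exact mul_le_of_le_one_left h0 (hκ μ)
          refine (Finset.sum_le_card_nsmul _ _ _ this).trans (le_of_eq ?_)
          simp
      _ ≤ _ := by
          rw [← Finset.mul_sum]
          gcongr
          exact sum_tent_le hM.connected hD₁ hD₂ hC₀ hM.dimension hβ₁ hR
  have main := M.norm_groundExpectation_le_exp hΔE hσ hHK hdK (hκM f) h1 hε hL hδ (hA f) hA4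
  rw [tent_self_sub hD₂] at main
  -- The prefactor `12` is `3 * 4`, where `4` bounds the norm of the observable.
  convert main using 2
  · norm_num
  · congr 1
    ring

theorem decaysInLimit_of_shifts {Λ : ℕ → Type} [∀ k, Fintype (Λ k)] [∀ k, LinearOrder (Λ k)]
    {M : ∀ k, Model (Λ k)} {D C₀ tmax Vmax Bmax ΔE : ℝ} {r₀ : ℕ} (hD₁ : 1 ≤ D) (hD₂ : D < 2)
    (hC₀ : 0 < C₀) (hΔE : 0 < ΔE) (hM : ∀ k, (M k).IsAdmissible D C₀ tmax Vmax Bmax r₀)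
    {K : ∀ k, Submodule ℂ (Fock (Λ k))} {σ₀ : ℕ → Finset ℝ}
    (hσ : HasUniformGap (fun k => (M k).hamiltonian) K σ₀ ΔE)
    (hHK : ∀ k, ∀ x ∈ K k, Matrix.toEuclideanLin (M k).hamiltonian x ∈ K k)
    (hdK : ∀ k d, ∀ x ∈ K k, Matrix.toEuclideanLin (Matrix.diagonal d : Op (Λ k)) x ∈ K k)
    {κ : Spin → ℝ} (hκ : ∀ μ, |κ μ| ≤ 1)
    (hκM : ∀ k f, Shifts (modeWeight κ f) (M k).onsite 0)
    {A : ∀ k, Λ k → Λ k → Op (Λ k)} {p : ℝ}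
    (hA : ∀ k m n f, Shifts (modeWeight κ f) (A k m n) (p * (f m - f n)))
    (hA4 : ∀ k m n, ‖A k m n‖ ≤ 4) :
    DecaysInLimit M K σ₀ A D 12 (p * decayRate C₀ tmax ΔE) := by
  intro R
  -- The exponential factor depends on `R` but not on `k`, so its product with the width of the
  -- sector tends to zero.
  have hlim := hσ.2.const_mul (Real.exp (2 * (2 * ((1 + C₀) * (R : ℝ) ^ 3))))
  rw [mul_zero] at hlim
  filter_upwards [hlim.eventually_le_const (by positivity : 0 < ΔE / 128)] with k hk m n hmn
  exact (M k).norm_groundExpectation_le_exp_dist hD₁ hD₂ hC₀ hΔE (hM k) (hσ.1 k) (hHK k) (hdK k)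
    hκ (hκM k) hmn hk (hA k m n) (hA4 k m n)

/-! ### The sectors and the observables -/

theorem mem_eigenspaceOf_chargeOp {φ : Mode Λ → ℝ} {A : Op Λ} (hA : Shifts φ A 0) {z : ℂ}
    {x : Fock Λ} (hx : x ∈ eigenspaceOf (chargeOp φ) z) :
    Matrix.toEuclideanLin A x ∈ eigenspaceOf (chargeOp φ) z := by
  rw [eigenspaceOf, Module.End.mem_eigenspace_iff] at hx ⊢
  rw [← toEuclideanLin_mul_apply, hA.chargeOp_mul, Complex.ofReal_zero, zero_smul, add_zero,
    toEuclideanLin_mul_apply, hx, map_smul]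

theorem mem_numberSector {A : Op Λ} (hA : Shifts (fun _ => 1) A 0) {N : ℕ}
    {x : Fock Λ} (hx : x ∈ numberSector Λ N) : Matrix.toEuclideanLin A x ∈ numberSector Λ N := by
  rw [numberSector, totalNumber_eq_chargeOp] at hx ⊢
  exact mem_eigenspaceOf_chargeOp hA hx

theorem mem_numberSpinSector {A : Op Λ} (hA : Shifts (fun _ => 1) A 0)
    (hA' : Shifts (fun x => if (ofLex x).2 = up then 1 else -1) A 0) {N : ℕ} {a : ℝ}
    {x : Fock Λ} (hx : x ∈ numberSpinSector Λ N a) :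
    Matrix.toEuclideanLin A x ∈ numberSpinSector Λ N a := by
  refine ⟨mem_numberSector hA hx.1, ?_⟩
  have hx2 := hx.2
  rw [totalSpinZ_eq_chargeOp] at hx2 ⊢
  exact mem_eigenspaceOf_chargeOp hA' hx2

/-- Weights constant over the sites are blind to hopping, which preserves the spin; total number and
magnetization are of this kind. -/
theorem Model.shifts_hamiltonian (M : Model Λ) {φ : Mode Λ → ℝ}
    (h : ∀ i j μ, φ (mode i μ) = φ (mode j μ)) (hφ : Shifts φ M.onsite 0) :
    Shifts φ M.hamiltonian 0 := by
  classical
  rw [M.hamiltonian_eq]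
  refine Shifts.add (Shifts.neg (Shifts.sum fun i _ => Shifts.sum fun j _ => ?_)) hφ
  split_ifs
  · exact Shifts.sum fun μ _ => ((shifts_create_mul_annihilate φ i j μ μ).congr
      (by rw [h i j μ, sub_self])).smul _
  · exact Shifts.zero

theorem Model.shifts_hamiltonian_one (M : Model Λ) : Shifts (fun _ => 1) M.hamiltonian 0 :=
  M.shifts_hamiltonian (fun _ _ _ => rfl) (M.shifts_onsite fun _ => Or.inl rfl)

theorem norm_pair_le (m n : Λ) :
    ‖create m up * create m down * annihilate n up * annihilate n down‖ ≤ 1 :=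
  (norm_mul_le _ _).trans (mul_le_one₀ ((norm_mul_le _ _).trans (mul_le_one₀
    ((norm_mul_le _ _).trans (mul_le_one₀ (norm_create_le m up) (norm_nonneg _)
      (norm_create_le m down))) (norm_nonneg _) (norm_annihilate_le n up))) (norm_nonneg _)
    (norm_annihilate_le n down))

theorem norm_spinPlus_mul_spinMinus_le (m n : Λ) : ‖spinPlus m * spinMinus n‖ ≤ 4 := by
  rw [spinPlus_eq, spinMinus_eq]
  have h : ∀ (i : Λ) (μ ν : Spin), ‖(2 : ℂ) • (create i μ * annihilate i ν)‖ ≤ 2 := fun i μ ν => by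
    rw [norm_smul, Complex.norm_ofNat]
    linarith [norm_create_mul_annihilate_le i i μ ν]
  calc _ ≤ _ := norm_mul_le _ _
    _ ≤ 2 * 2 := mul_le_mul (h _ _ _) (h _ _ _) (norm_nonneg _) zero_le_two
    _ = 4 := by norm_num

theorem shifts_hop (m n : Λ) (μ : Spin) (f : Λ → ℝ) :
    Shifts (modeWeight (fun _ => 1) f) (create m μ * annihilate n μ) (1 * (f m - f n)) :=
  (shifts_create_mul_annihilate _ m n μ μ).congr (by simp)

theorem shifts_pair (m n : Λ) (f : Λ → ℝ) :
    Shifts (modeWeight (fun _ => 1) f)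
      (create m up * create m down * annihilate n up * annihilate n down) (2 * (f m - f n)) :=
  ((((shifts_create _ m up).mul (shifts_create _ m down)).mul (shifts_annihilate _ n up)).mul
    (shifts_annihilate _ n down)).congr (by simp; ring)

/-- Spin flips are neutral for the electron number, so the twist acts on up electrons alone. This is
what requires fields along `z`. -/
theorem shifts_spinPlus_mul_spinMinus (m n : Λ) (f : Λ → ℝ) :
    Shifts (modeWeight ![1, 0] f) (spinPlus m * spinMinus n) (1 * (f m - f n)) := by
  rw [spinPlus_eq, spinMinus_eq]
  exact (((shifts_create_mul_annihilate _ m m up down).smul 2).mul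
    ((shifts_create_mul_annihilate _ n n down up).smul 2)).congr (by simp; ring)

/-- The bounds on the three correlation functions in sectors invariant under the Hamiltonian and
under the operators diagonal in the occupation numbers. -/
theorem decaysInLimit_correlations {Λ : ℕ → Type} [∀ k, Fintype (Λ k)] [∀ k, LinearOrder (Λ k)]
    {M : ∀ k, Model (Λ k)} {D C₀ tmax Vmax Bmax ΔE : ℝ} {r₀ : ℕ} (hD₁ : 1 ≤ D) (hD₂ : D < 2)
    (hC₀ : 0 < C₀) (hΔE : 0 < ΔE) (hM : ∀ k, (M k).IsAdmissible D C₀ tmax Vmax Bmax r₀)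
    {K : ∀ k, Submodule ℂ (Fock (Λ k))} {σ₀ : ℕ → Finset ℝ}
    (hσ : HasUniformGap (fun k => (M k).hamiltonian) K σ₀ ΔE)
    (hHK : ∀ k, ∀ x ∈ K k, Matrix.toEuclideanLin (M k).hamiltonian x ∈ K k)
    (hdK : ∀ k d, ∀ x ∈ K k, Matrix.toEuclideanLin (Matrix.diagonal d : Op (Λ k)) x ∈ K k) :
    (∀ μ : Spin, DecaysInLimit M K σ₀ (fun _ m n => create m μ * annihilate n μ) D 12
      (decayRate C₀ tmax ΔE)) ∧
    DecaysInLimit M K σ₀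
      (fun _ m n => create m up * create m down * annihilate n up * annihilate n down) D 12
      (2 * decayRate C₀ tmax ΔE) ∧
    ((∀ k i, (M k).field i 0 = 0 ∧ (M k).field i 1 = 0) →
      DecaysInLimit M K σ₀ (fun _ m n => spinPlus m * spinMinus n) D 12
        (decayRate C₀ tmax ΔE)) := by
  refine ⟨fun μ => ?_, ?_, fun hB => ?_⟩
  · rw [← one_mul (decayRate C₀ tmax ΔE)]
    exact decaysInLimit_of_shifts hD₁ hD₂ hC₀ hΔE hM hσ hHK hdK (κ := fun _ => 1) (by simp)
      (fun k f => (M k).shifts_onsite fun i => Or.inl rfl) (fun _ m n f => shifts_hop m n μ f)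
      fun _ m n => (norm_create_mul_annihilate_le m n μ μ).trans (by norm_num)
  · exact decaysInLimit_of_shifts hD₁ hD₂ hC₀ hΔE hM hσ hHK hdK (κ := fun _ => 1) (by simp)
      (fun k f => (M k).shifts_onsite fun i => Or.inl rfl) (fun _ m n f => shifts_pair m n f)
      fun _ m n => (norm_pair_le m n).trans (by norm_num)
  · rw [← one_mul (decayRate C₀ tmax ΔE)]
    exact decaysInLimit_of_shifts hD₁ hD₂ hC₀ hΔE hM hσ hHK hdK (κ := ![1, 0])
      (fun μ => by fin_cases μ <;> simp)
      (fun k f => (M k).shifts_onsite fun i => Or.inr (hB k i))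
      (fun _ m n f => shifts_spinPlus_mul_spinMinus m n f)
      fun _ m n => norm_spinPlus_mul_spinMinus_le m n

end Decay

end LatticeElectron

end

theorem mainTheorem3 (D C₀ tmax Vmax Bmax ΔE : ℝ) (r₀ : ℕ)
    (hD₁ : 1 ≤ D) (hD₂ : D < 2) (hC₀ : 0 < C₀) (hΔE : 0 < ΔE) :
    ∃ γ > 0, ∃ γ' > 0, ∃ C > 0,
      ∀ (Λ : ℕ → Type) [∀ k, Fintype (Λ k)] [∀ k, LinearOrder (Λ k)]
        (M : ∀ k, LatticeElectron.Model (Λ k)),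
        Filter.Tendsto (fun k => Fintype.card (Λ k)) Filter.atTop Filter.atTop →
        (∀ k, (M k).IsAdmissible D C₀ tmax Vmax Bmax r₀) →
        ∀ (N : ℕ → ℕ) (σ₀ : ℕ → Finset ℝ),
          -- a uniform gap at fixed particle number
          (LatticeElectron.HasUniformGap (fun k => (M k).hamiltonian)
              (fun k => LatticeElectron.numberSector (Λ k) (N k)) σ₀ ΔE →
            (∀ μ : LatticeElectron.Spin,
              LatticeElectron.DecaysInLimit M
                (fun k => LatticeElectron.numberSector (Λ k) (N k)) σ₀
                (fun _ m n => LatticeElectron.create m μ * LatticeElectron.annihilate n μ)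
                D C γ) ∧
            LatticeElectron.DecaysInLimit M
              (fun k => LatticeElectron.numberSector (Λ k) (N k)) σ₀
              (fun _ m n => LatticeElectron.create m LatticeElectron.up *
                LatticeElectron.create m LatticeElectron.down *
                LatticeElectron.annihilate n LatticeElectron.up *
                LatticeElectron.annihilate n LatticeElectron.down)
              D C (2 * γ) ∧
            ((∀ k i, (M k).field i 0 = 0 ∧ (M k).field i 1 = 0) →
              LatticeElectron.DecaysInLimit M
                (fun k => LatticeElectron.numberSector (Λ k) (N k)) σ₀
                (fun _ m n => LatticeElectron.spinPlus m * LatticeElectron.spinMinus n)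
                D C γ')) ∧
          -- fields along z: a uniform gap at fixed particle number and total magnetization
          ((∀ k i, (M k).field i 0 = 0 ∧ (M k).field i 1 = 0) →
            ∀ (m_z : ℕ → ℝ),
            LatticeElectron.HasUniformGap (fun k => (M k).hamiltonian)
              (fun k => LatticeElectron.numberSpinSector (Λ k) (N k) (m_z k)) σ₀ ΔE →
            (∀ μ : LatticeElectron.Spin,
              LatticeElectron.DecaysInLimit M
                (fun k => LatticeElectron.numberSpinSector (Λ k) (N k) (m_z k)) σ₀
                (fun _ m n => LatticeElectron.create m μ * LatticeElectron.annihilate n μ)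
                D C γ) ∧
            LatticeElectron.DecaysInLimit M
              (fun k => LatticeElectron.numberSpinSector (Λ k) (N k) (m_z k)) σ₀
              (fun _ m n => LatticeElectron.create m LatticeElectron.up *
                LatticeElectron.create m LatticeElectron.down *
                LatticeElectron.annihilate n LatticeElectron.up *
                LatticeElectron.annihilate n LatticeElectron.down)
              D C (2 * γ) ∧
            LatticeElectron.DecaysInLimit M
              (fun k => LatticeElectron.numberSpinSector (Λ k) (N k) (m_z k)) σ₀
              (fun _ m n => LatticeElectron.spinPlus m * LatticeElectron.spinMinus n)
              D C γ') := by
  have hpos := LatticeElectron.decayRate_pos (tmax := tmax) hC₀ hΔE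
  refine ⟨LatticeElectron.decayRate C₀ tmax ΔE, hpos, LatticeElectron.decayRate C₀ tmax ΔE, hpos,
    12, by norm_num, ?_⟩
  intro Λ _ _ M _ hM N σ₀
  refine ⟨fun hσ => ?_, fun hB m_z hσ => ?_⟩
  · exact LatticeElectron.decaysInLimit_correlations hD₁ hD₂ hC₀ hΔE hM hσ
      (fun k _ hx => LatticeElectron.mem_numberSector (M k).shifts_hamiltonian_one hx)
      (fun _ d _ hx => LatticeElectron.mem_numberSector (LatticeElectron.shifts_diagonal _ d) hx)
  · obtain ⟨h1, h2, h3⟩ := LatticeElectron.decaysInLimit_correlations hD₁ hD₂ hC₀ hΔE hM hσ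
      (fun k _ hx => LatticeElectron.mem_numberSpinSector (M k).shifts_hamiltonian_one
        ((M k).shifts_hamiltonian (fun _ _ _ => rfl)
          ((M k).shifts_onsite fun i => Or.inr (hB k i))) hx)
      (fun _ d _ hx => LatticeElectron.mem_numberSpinSector
        (LatticeElectron.shifts_diagonal _ d) (LatticeElectron.shifts_diagonal _ d) hx)
    exact ⟨h1, h2, h3 hB⟩
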